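/- Let $n\ge 2$, let $\Omega\subset\mathbb R^n$ be a bounded domain, let $p>1$, $q\ge 1$ with $q>p-1$, and put $s=\frac{q}{q-p+1}>1$. Let $\mathcal A:\mathbb R^n\times\mathbb R^n\to\mathbb R^n$ be a Carathéodory function ($\mathcal A(\cdot,\xi)$ is measurable for every $\xi$, and $\mathcal A(x,\cdot)$ is continuous for a.e. $x$) such that, for some constant $\Lambda$, $|\mathcal A(x,\xi)|\le\Lambda|\xi|^{p-1}$ for a.e. $x$ and all $\xi$. For compact $K\subset\mathbb R^n$ let $$\mathrm{Cap}_{1,s}(K)=\inf\Big\{\int_{\mathbb R^n}(|\nabla\varphi|^s+\varphi^s)\,dx:\ \varphi\in C_0^\infty(\mathbb R^n),\ \varphi\ge\chi_K\Big\},$$ and let $M^{1,s}(\Omega)$ be the set of signed measures $\mu$ of bounded total variation in $\Omega$ with $$\sup\big\{|\mu|(K)/\mathrm{Cap}_{1,s}(K):\ K\subset\Omega \text{ compact},\ \mathrm{Cap}_{1,s}(K)>0\big\}<\infty.$$ A function $g\in L^1(\Omega)$ is identified with the measure $g\,dx$. Suppose that $\sigma$ is a distribution in $\Omega$ such that the equation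 $$-\mathrm{div}\,\mathcal A(x,\nabla u)=|\nabla u|^q+\sigma\quad\text{in }\mathcal D'(\Omega)$$ has a solution $u\in W^{1,q}(\Omega)$ with $|\nabla u|^q\in M^{1,s}(\Omega)$. Then there is a vector field $\mathbf f$ on $\Omega$ such that $\sigma=\mathrm{div}\,\mathbf f$ in $\mathcal D'(\Omega)$ and $|\mathbf f|^{\frac{q}{p-1}}\in M^{1,s}(\Omega)$. In particular, $\sigma\in W^{-1,\frac{q}{p-1}}(\Omega)$, the dual space of $W^{1,s}_0(\Omega)$. Moreover, there is a constant $C$ such that for all $\varphi\in C_0^\infty(\Omega)$ $$\big|\big\langle\sigma,|\varphi|^{s}\big\rangle\big|\le C\int_\Omega|\nabla\varphi|^{s}\,dx .$$ Here $|\varphi|^s\in W^{1,s}_0(\Omega)$, and $\langle\sigma,\cdot\rangle$ is the continuous extension of $\sigma$ to $W^{1,s}_0(\Omega)$. -/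

import Mathlib

open MeasureTheory TopologicalSpace Filter Topology
open scoped ENNReal Distributions ContDiff

namespace Riccati

/-- `ℝⁿ` with its Euclidean norm. -/
abbrev Rn (n : ℕ) : Type := EuclideanSpace ℝ (Fin n)

/-- The capacity `Cap_{1,s}(K)` of the Sobolev space `W^{1,s}(ℝⁿ)`: the infimum of
`∫ |∇φ|^s + φ^s` over `φ ∈ C_c^∞(ℝⁿ)` with `φ ≥ χ_K` everywhere. -/
noncomputable def cap {n : ℕ} (s : ℝ) (K : Set (Rn n)) : ℝ≥0∞ :=
  ⨅ (φ : Rn n → ℝ) (_ : ContDiff ℝ ∞ φ) (_ : HasCompactSupport φ)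
    (_ : ∀ x, K.indicator (fun _ => (1 : ℝ)) x ≤ φ x),
    ∫⁻ x, ENNReal.ofReal (‖gradient φ x‖ ^ s + φ x ^ s)

/-- The quantity `[μ]_{M^{1,s}(Ω)}`: the supremum of `|μ|(K) / Cap_{1,s}(K)` over the compact
sets `K ⊆ Ω` of positive capacity. -/
noncomputable def capSeminorm {n : ℕ} (s : ℝ) (Ω : Set (Rn n)) (μ : SignedMeasure (Rn n)) :
    ℝ≥0∞ :=
  ⨆ (K : Set (Rn n)) (_ : IsCompact K) (_ : K ⊆ Ω) (_ : 0 < cap s K),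
    μ.totalVariation K / cap s K

/-- `μ ∈ M^{1,s}(Ω)` for a signed measure `μ` of bounded variation on `Ω` (extended by zero
outside `Ω`; a `SignedMeasure` always has finite total variation). -/
def MemM {n : ℕ} (s : ℝ) (Ω : Set (Rn n)) (μ : SignedMeasure (Rn n)) : Prop :=
  μ.totalVariation Ωᶜ = 0 ∧ capSeminorm s Ω μ < ⊤

/-- A function `g` on `Ω` belongs to `M^{1,s}(Ω)` if it is integrable on `Ω` and the signed measure
`g dx` on `Ω` belongs to `M^{1,s}(Ω)`. -/
def FunMemM {n : ℕ} (s : ℝ) (Ω : Set (Rn n)) (g : Rn n → ℝ) : Prop :=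
  IntegrableOn g Ω volume ∧ MemM s Ω ((volume.restrict Ω).withDensityᵥ g)

/-- `G` is the weak (distributional) gradient of `u` in `Ω`. -/
def IsWeakGradient {n : ℕ} (Ω : Opens (Rn n)) (u : Rn n → ℝ) (G : Rn n → Rn n) : Prop :=
  LocallyIntegrableOn u Ω volume ∧ LocallyIntegrableOn G Ω volume ∧
    ∀ φ : 𝓓(Ω, ℝ), ∫ x in (Ω : Set (Rn n)), u x • gradient φ x
      = - ∫ x in (Ω : Set (Rn n)), φ x • G x

/-- `u ∈ W^{1,r}(Ω)` with weak gradient `G`. -/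
def MemSobolev {n : ℕ} (Ω : Opens (Rn n)) (r : ℝ) (u : Rn n → ℝ) (G : Rn n → Rn n) : Prop :=
  MemLp u (ENNReal.ofReal r) (volume.restrict Ω) ∧
    MemLp G (ENNReal.ofReal r) (volume.restrict Ω) ∧ IsWeakGradient Ω u G

/-- The first growth condition, together with the Carathéodory property: `A(·, ξ)` is (Lebesgue)
measurable for every `ξ`, and for a.e. `x` the map `A(x, ·)` is continuous and
`|A(x, ξ)| ≤ Λ |ξ|^{p-1}` for all `ξ`. -/
structure IsCaratheodoryWithGrowth {n : ℕ} (A : Rn n → Rn n → Rn n) (p Λ : ℝ) : Prop where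
  measurable : ∀ ξ, AEMeasurable (fun x => A x ξ) volume
  continuous : ∀ᵐ x, Continuous (A x)
  growth : ∀ᵐ x, ∀ ξ, ‖A x ξ‖ ≤ Λ * ‖ξ‖ ^ (p - 1)

/-- `-div A(x, ∇u) = |∇u|^q + σ` in `𝓓'(Ω)`, where `Du` is the weak gradient of `u`. The
fields `A(x, Du)` and `|Du|^q` are required to be locally integrable, so that they are
distributions. -/
def SolvesRiccati {n : ℕ} (Ω : Opens (Rn n)) (A : Rn n → Rn n → Rn n) (q : ℝ)
    (Du : Rn n → Rn n) (σ : 𝓓'(Ω, ℝ)) : Prop :=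
  LocallyIntegrableOn (fun x => A x (Du x)) Ω volume ∧
  LocallyIntegrableOn (fun x => ‖Du x‖ ^ q) Ω volume ∧
    ∀ φ : 𝓓(Ω, ℝ), ∫ x in (Ω : Set (Rn n)), inner ℝ (A x (Du x)) (gradient φ x)
      = (∫ x in (Ω : Set (Rn n)), ‖Du x‖ ^ q * φ x) + σ φ

/-- `σ = div f` in `𝓓'(Ω)` for the locally integrable vector field `f` on `Ω`. -/
def IsDiv {n : ℕ} (Ω : Opens (Rn n)) (σ : 𝓓'(Ω, ℝ)) (f : Rn n → Rn n) : Prop :=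
  LocallyIntegrableOn f Ω volume ∧
    ∀ φ : 𝓓(Ω, ℝ), σ φ = - ∫ x in (Ω : Set (Rn n)), inner ℝ (f x) (gradient φ x)

/-- `σ ∈ W^{-1,r}(Ω)`, the dual space of `W_0^{1,r'}(Ω)` with `r' = r/(r-1)`. As test functions
are dense in `W_0^{1,r'}(Ω)`, this says that `σ` is bounded on test functions for the
`W^{1,r'}(Ω)`-norm. -/
def MemNegSobolev {n : ℕ} (Ω : Opens (Rn n)) (r : ℝ) (σ : 𝓓'(Ω, ℝ)) : Prop :=
  ∃ C : ℝ, ∀ φ : 𝓓(Ω, ℝ), |σ φ| ≤ C *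
    (∫ x in (Ω : Set (Rn n)), (|φ x| ^ r.conjExponent + ‖gradient φ x‖ ^ r.conjExponent))
      ^ (1 / r.conjExponent)

/-- The test functions `φ k` converge to `v` in `W^{1,s}(Ω)`. -/
def TendstoSobolev {n : ℕ} (Ω : Opens (Rn n)) (s : ℝ) (φ : ℕ → 𝓓(Ω, ℝ)) (v : Rn n → ℝ) : Prop :=
  ∃ Dv : Rn n → Rn n, MemSobolev Ω s v Dv ∧
    Tendsto (fun k => eLpNorm (fun x => φ k x - v x) (ENNReal.ofReal s) (volume.restrict Ω))
      atTop (𝓝 0) ∧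
    Tendsto (fun k => eLpNorm (fun x => gradient (φ k) x - Dv x) (ENNReal.ofReal s)
      (volume.restrict Ω)) atTop (𝓝 0)

/-- `v ∈ W_0^{1,s}(Ω)`, the closure of the test functions in `W^{1,s}(Ω)`. -/
def MemSobolevZero {n : ℕ} (Ω : Opens (Rn n)) (s : ℝ) (v : Rn n → ℝ) : Prop :=
  ∃ φ : ℕ → 𝓓(Ω, ℝ), TendstoSobolev Ω s φ v

/-- `⟨σ, v⟩ = ℓ`, where the pairing of `σ ∈ W^{-1,s'}(Ω)` with `v ∈ W_0^{1,s}(Ω)` is the extension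
by continuity of the pairing with test functions: `v ∈ W_0^{1,s}(Ω)`, and `σ(φ_k) → ℓ` for every
sequence of test functions `φ_k → v` in `W^{1,s}(Ω)`. -/
def HasPairing {n : ℕ} (Ω : Opens (Rn n)) (s : ℝ) (σ : 𝓓'(Ω, ℝ)) (v : Rn n → ℝ) (ℓ : ℝ) : Prop :=
  MemSobolevZero Ω s v ∧
    ∀ φ : ℕ → 𝓓(Ω, ℝ), TendstoSobolev Ω s φ v → Tendsto (fun k => σ (φ k)) atTop (𝓝 ℓ)

end Riccati

/-! Write r = q/(p-1), the conjugate exponent of s, and g = |∇u|^q. The heart of the matter is a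
field F with -div F = g and |F|^r ∈ M^{1,s}(Ω). Then f = F - A(x,∇u) works: the equation gives σ =
div f, and |A(x,∇u)|^r ≤ |Λ|^r g by the growth condition.

The field F comes from duality, without potentials or singular integrals. First, domination of g dx
by the capacity is upgraded to a trace inequality ∫|φ|^s g ≤ C ∫|∇φ|^s
(`exists_trace_inequality_smooth`, by smooth truncation at every level, then `poincare_inequality`).
Call a positive C¹ function v a barrier if it equals a constant d outside a ball, with energy E(v) =
∫|∇v|^s + d^s. On bounded fields G consider the gauge N(G) = inf_v (∫|G|^s v^(s-s²) + E(v)). It is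
sublinear: scaling v by c^(1/s) gives homogeneity, and combining barriers as (v₁^s + v₂^s)^(1/s)
gives subadditivity by convexity of (a,α) ↦ |a|^s α^(1-s).

The key estimate is ∫|ψ| g ≤ K N(∇ψ) (`TraceInequality.exists_dual_estimate`). Given v, take an
almost minimizer h of the energy among barriers above v. Testing minimality with h + t|ψ|^s h^(1-s²)
yields the Hardy inequality ∫|ψ|^s h^(-s²)|∇h|^s ≤ C ∫|∇ψ|^s h^(s-s²), up to a small error. The
trace inequality for φ = ψ h^(1-s), together with |ψ| ≤ |φ|^s + h^s, finishes the estimate.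

By Hahn–Banach, the functional ∇ψ ↦ ∫ψ g extends to bounded fields, still below K N. Constant
barriers make it continuous for the L^s seminorm, so Radon–Nikodym gives a density F
(`exists_dual_field`). Testing with truncations of κ|F|^(r-2) v^s F yields ∫|F|^r v^s ≤ K' E(v) for
every barrier (`exists_lintegral_norm_rpow_le`). Taking v = d + χφ with φ admissible for the
capacity and letting d → 0 gives |F|^r ∈ M^{1,s}(Ω).

The negative Sobolev bound is Hölder's inequality. The last inequality follows from |∇|φ|^s| =
s|φ|^(s-1)|∇φ|, Young's inequality and the trace inequality for |f|^r. -/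

namespace Riccati

/-! ### Nonnegative densities dominated by the capacity -/

/-- The total variation of the signed measure `g dx` for a nonnegative integrable density `g`. -/
theorem totalVariation_withDensityᵥ_of_nonneg {α : Type*} [MeasurableSpace α] {μ : Measure α}
    {g : α → ℝ} (hg : Integrable g μ) (h0 : ∀ x, 0 ≤ g x) :
    SignedMeasure.totalVariation (μ.withDensityᵥ g) =
      μ.withDensity (fun x => ENNReal.ofReal (g x)) := by
  have hfin : IsFiniteMeasure (μ.withDensity fun x => ENNReal.ofReal (g x)) :=
    isFiniteMeasure_withDensity_ofReal hg.2
  let j : JordanDecomposition α :=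
    ⟨μ.withDensity (fun x => ENNReal.ofReal (g x)), 0, Measure.MutuallySingular.zero_right⟩
  have hj : μ.withDensityᵥ g = j.toSignedMeasure := by
    rw [withDensityᵥ_eq_withDensity_pos_part_sub_withDensity_neg_part hg]
    ext i hi
    have h2 : (μ.withDensity fun x => ENNReal.ofReal (-g x)) = 0 := by
      have : (fun x => ENNReal.ofReal (-g x)) = 0 := by
        ext x; simp [ENNReal.ofReal_eq_zero, h0 x]
      rw [this, withDensity_zero]
    simp [JordanDecomposition.toSignedMeasure, j, Measure.toSignedMeasure_apply_measurable hi, h2]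
  rw [SignedMeasure.totalVariation, SignedMeasure.toJordanDecomposition_eq hj]
  simp [j]

theorem totalVariation_density_apply {n : ℕ} {Ω : Set (Rn n)} {g : Rn n → ℝ}
    (hg : IntegrableOn g Ω) (h0 : ∀ x, 0 ≤ g x) {K : Set (Rn n)} (hK : IsCompact K)
    (hKΩ : K ⊆ Ω) :
    SignedMeasure.totalVariation ((volume.restrict Ω).withDensityᵥ g) K =
      ∫⁻ x in K, ENNReal.ofReal (g x) := by
  rw [totalVariation_withDensityᵥ_of_nonneg hg h0, withDensity_apply _ hK.measurableSet,
    Measure.restrict_restrict_of_subset hKΩ]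

/-- The zero-order term φ^s of the capacity is at least 1 on K. Hence sets of zero capacity are
Lebesgue null, and the supremum defining M^{1,s} loses nothing by ignoring them. -/
theorem volume_le_cap {n : ℕ} {s : ℝ} (hs : 0 ≤ s) {K : Set (Rn n)} (hK : IsCompact K) :
    volume K ≤ cap s K := by
  refine le_iInf fun φ => le_iInf fun _ => le_iInf fun _ => le_iInf fun h => ?_
  rw [← lintegral_indicator_one hK.measurableSet]
  refine lintegral_mono fun x => ?_
  by_cases hx : x ∈ K
  · have h1 : 1 ≤ φ x := by simpa [hx] using h x
    have h2 : 1 ≤ φ x ^ s := Real.one_le_rpow h1 hs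
    have h3 : 0 ≤ ‖gradient φ x‖ ^ s := by positivity
    simp only [hx, Set.indicator_of_mem, Pi.one_apply]
    rw [← ENNReal.ofReal_one]
    exact ENNReal.ofReal_le_ofReal (by linarith)
  · simp [hx]

theorem FunMemM.exists_lintegral_le {n : ℕ} {s : ℝ} (hs : 0 ≤ s) {Ω : Set (Rn n)} {g : Rn n → ℝ}
    (h0 : ∀ x, 0 ≤ g x) (h : FunMemM s Ω g) :
    ∃ C : ℝ≥0∞, C ≠ ⊤ ∧ ∀ K : Set (Rn n), IsCompact K → K ⊆ Ω →
      ∫⁻ x in K, ENNReal.ofReal (g x) ≤ C * cap s K := by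
  -- The `+ 1` makes the constant nonzero, so that the bound is also trivially true when `cap s K =
  -- ⊤`.
  refine ⟨capSeminorm s Ω ((volume.restrict Ω).withDensityᵥ g) + 1,
    ENNReal.add_ne_top.2 ⟨h.2.2.ne, ENNReal.one_ne_top⟩, fun K hK hKΩ => ?_⟩
  rcases eq_or_ne (cap s K) 0 with h1 | h1
  · have : volume K = 0 := le_antisymm (h1 ▸ volume_le_cap hs hK) (zero_le)
    rw [Measure.restrict_eq_zero.2 this]
    simp
  · have h2 : SignedMeasure.totalVariation ((volume.restrict Ω).withDensityᵥ g) K / cap s K ≤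
        capSeminorm s Ω ((volume.restrict Ω).withDensityᵥ g) :=
      le_iSup_of_le K <| le_iSup_of_le hK <| le_iSup_of_le hKΩ <|
        le_iSup_of_le (pos_iff_ne_zero.2 h1) le_rfl
    rw [totalVariation_density_apply h.1 h0 hK hKΩ] at h2
    rcases eq_or_ne (cap s K) ⊤ with h3 | h3
    · rw [h3, ENNReal.mul_top (by simp)]; exact le_top
    · exact ((ENNReal.div_le_iff h1 h3).1 h2).trans (by gcongr; exact le_self_add)

theorem funMemM_of_lintegral_le {n : ℕ} {s : ℝ} {Ω : Set (Rn n)} (hΩ : MeasurableSet Ω)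
    {g : Rn n → ℝ} (h0 : ∀ x, 0 ≤ g x) (hg : IntegrableOn g Ω) {C : ℝ≥0∞} (hC : C ≠ ⊤)
    (h : ∀ K : Set (Rn n), IsCompact K → K ⊆ Ω →
      ∫⁻ x in K, ENNReal.ofReal (g x) ≤ C * cap s K) :
    FunMemM s Ω g := by
  refine ⟨hg, ?_, lt_of_le_of_lt ?_ hC.lt_top⟩
  · rw [totalVariation_withDensityᵥ_of_nonneg hg h0, withDensity_apply _ hΩ.compl]
    simp [Measure.restrict_restrict hΩ.compl]
  · refine iSup_le fun K => iSup_le fun hK => iSup_le fun hKΩ => iSup_le fun _ => ?_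
    rw [totalVariation_density_apply hg h0 hK hKΩ]
    exact ENNReal.div_le_of_le_mul (h K hK hKΩ)

/-! ### Smooth truncation at a level -/

theorem norm_gradient {n : ℕ} (f : Rn n → ℝ) (x : Rn n) : ‖gradient f x‖ = ‖fderiv ℝ f x‖ := by
  simp [gradient]

theorem continuous_gradient {n : ℕ} {f : Rn n → ℝ} (hf : ContDiff ℝ 1 f) :
    Continuous (gradient f) :=
  (InnerProductSpace.toDual ℝ (Rn n)).symm.continuous.comp (hf.continuous_fderiv one_ne_zero)

theorem deriv_smoothTransition_eq_zero {x : ℝ} (hx : x < 0 ∨ 1 < x) :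
    deriv Real.smoothTransition x = 0 := by
  rcases hx with hx | hx
  · have : Real.smoothTransition =ᶠ[𝓝 x] fun _ => 0 := by
      filter_upwards [eventually_lt_nhds hx] with y hy
      exact Real.smoothTransition.zero_of_nonpos hy.le
    rw [this.deriv_eq, deriv_const]
  · have : Real.smoothTransition =ᶠ[𝓝 x] fun _ => 1 := by
      filter_upwards [eventually_gt_nhds hx] with y hy
      exact Real.smoothTransition.one_of_one_le hy.le
    rw [this.deriv_eq, deriv_const]

theorem exists_abs_deriv_smoothTransition_le :
    ∃ M : ℝ, 0 < M ∧ ∀ x, |deriv Real.smoothTransition x| ≤ M := by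
  have hc : Continuous (deriv Real.smoothTransition) :=
    (Real.smoothTransition.contDiff (n := 1)).continuous_deriv le_rfl
  have hs : HasCompactSupport (deriv Real.smoothTransition) := by
    refine HasCompactSupport.of_support_subset_isCompact (isCompact_Icc (a := (0 : ℝ)) (b := 1)) ?_
    intro x hx
    by_contra h
    refine hx (deriv_smoothTransition_eq_zero ?_)
    by_contra! h'
    exact h ⟨h'.1, h'.2⟩
  obtain ⟨C, hC⟩ := hc.bounded_above_of_compact_support hs
  exact ⟨max C 1, by positivity, fun x => (hC x).trans (le_max_left _ _)⟩

/-- The smooth truncation of `|φ|` at the level `t`: it is `1` where `t ≤ |φ|` and `0` where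
`|φ| ≤ t / 2`. -/
noncomputable def levelCutoff {n : ℕ} (φ : Rn n → ℝ) (t : ℝ) (x : Rn n) : ℝ :=
  Real.smoothTransition ((4 * (φ x / t) ^ 2 - 1) / 3)

section levelCutoff

variable {n : ℕ} {φ : Rn n → ℝ} {t : ℝ}

/-- The truncation depends on φ² instead of |φ|, so it is smooth also where φ vanishes. -/
theorem contDiff_levelCutoff (hφ : ContDiff ℝ ∞ φ) : ContDiff ℝ ∞ (levelCutoff φ t) :=
  Real.smoothTransition.contDiff.comp
    (((contDiff_const.mul ((hφ.div_const t).pow 2)).sub contDiff_const).div_const 3)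

theorem hasCompactSupport_levelCutoff (hφ : HasCompactSupport φ) :
    HasCompactSupport (levelCutoff φ t) :=
  hφ.comp_left (g := fun y => Real.smoothTransition ((4 * (y / t) ^ 2 - 1) / 3))
    (Real.smoothTransition.zero_of_nonpos (by norm_num))

theorem levelCutoff_nonneg (x : Rn n) : 0 ≤ levelCutoff φ t x := Real.smoothTransition.nonneg _

theorem levelCutoff_le_one (x : Rn n) : levelCutoff φ t x ≤ 1 := Real.smoothTransition.le_one _

theorem levelCutoff_eq_one (ht : 0 < t) {x : Rn n} (hx : t ≤ |φ x|) : levelCutoff φ t x = 1 := by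
  refine Real.smoothTransition.one_of_one_le ?_
  have h1 : 1 ≤ |φ x| / t := (one_le_div ht).2 hx
  have h2 : 1 ≤ (φ x / t) ^ 2 := by
    rw [← sq_abs, abs_div, abs_of_pos ht]; nlinarith
  linarith

theorem levelCutoff_eq_zero (ht : 0 < t) {x : Rn n} (hx : 2 * |φ x| ≤ t) :
    levelCutoff φ t x = 0 := by
  refine Real.smoothTransition.zero_of_nonpos ?_
  have h1 : |φ x| / t ≤ 1 / 2 := by rw [div_le_iff₀ ht]; linarith
  have h0 : 0 ≤ |φ x| / t := by positivity
  have h2 : (φ x / t) ^ 2 ≤ 1 / 4 := by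
    rw [← sq_abs, abs_div, abs_of_pos ht]; nlinarith
  linarith

theorem fderiv_levelCutoff (hφ : Differentiable ℝ φ) (x : Rn n) :
    fderiv ℝ (levelCutoff φ t) x =
      (deriv Real.smoothTransition ((4 * (φ x / t) ^ 2 - 1) / 3) * (8 / 3 * (φ x / t) / t)) •
        fderiv ℝ φ x := by
  have h2 : HasDerivAt Real.smoothTransition
      (deriv Real.smoothTransition ((4 * (φ x / t) ^ 2 - 1) / 3)) ((4 * (φ x / t) ^ 2 - 1) / 3) :=
    ((Real.smoothTransition.contDiff (n := 1)).differentiable one_ne_zero _).hasDerivAt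
  have h3 : HasDerivAt (fun y : ℝ => (4 * (y / t) ^ 2 - 1) / 3) (8 / 3 * (φ x / t) / t) (φ x) := by
    have := (((((hasDerivAt_id (φ x)).div_const t).pow 2).const_mul 4).sub_const 1).div_const 3
    refine this.congr_deriv ?_
    simp; ring
  exact ((h2.comp (φ x) h3).comp_hasFDerivAt x (hφ x).hasFDerivAt).fderiv

theorem norm_fderiv_levelCutoff_le {M : ℝ} (hM : ∀ x, |deriv Real.smoothTransition x| ≤ M)
    (hφ : Differentiable ℝ φ) (ht : 0 < t) (x : Rn n) :
    ‖fderiv ℝ (levelCutoff φ t) x‖ ≤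
      if |φ x| ≤ t ∧ t ≤ 2 * |φ x| then 3 * M * ‖fderiv ℝ φ x‖ / t else 0 := by
  have hM0 : 0 ≤ M := (abs_nonneg _).trans (hM 0)
  rw [fderiv_levelCutoff hφ, norm_smul, Real.norm_eq_abs, abs_mul]
  have e : |φ x / t| = |φ x| / t := by rw [abs_div, abs_of_pos ht]
  split_ifs with h
  · have h1 : |φ x| / t ≤ 1 := (div_le_one ht).2 h.1
    have h2 : |8 / 3 * (φ x / t) / t| ≤ 3 / t := by
      rw [abs_div, abs_mul, e, abs_of_pos ht, abs_of_pos (by norm_num : (0 : ℝ) < 8 / 3)]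
      gcongr
      nlinarith
    calc _ ≤ M * (3 / t) * ‖fderiv ℝ φ x‖ := by gcongr; exact hM _
      _ = _ := by ring
  · have h0 : 0 ≤ |φ x| / t := by positivity
    have : deriv Real.smoothTransition ((4 * (φ x / t) ^ 2 - 1) / 3) = 0 := by
      apply deriv_smoothTransition_eq_zero
      rw [← sq_abs, e]
      rw [not_and_or] at h
      rcases h with h | h
      · right
        have : 1 < |φ x| / t := (one_lt_div ht).2 (not_le.1 h)
        nlinarith
      · left
        have : |φ x| / t < 1 / 2 := by rw [div_lt_iff₀ ht]; linarith [not_le.1 h]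
        nlinarith
    simp [this]

end levelCutoff

/-! ### The capacitary strong type inequality -/

/-- The energy `∫ |∇φ|^s + |φ|^s` on the whole space. -/
noncomputable def sobolevEnergy {n : ℕ} (s : ℝ) (φ : Rn n → ℝ) : ℝ≥0∞ :=
  ∫⁻ x, ENNReal.ofReal (‖fderiv ℝ φ x‖ ^ s + |φ x| ^ s)

theorem cap_le {n : ℕ} {s : ℝ} {K : Set (Rn n)} {φ : Rn n → ℝ} (hφ : ContDiff ℝ ∞ φ)
    (hφc : HasCompactSupport φ) (h : ∀ x, K.indicator (fun _ => (1 : ℝ)) x ≤ φ x) :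
    cap s K ≤ ∫⁻ x, ENNReal.ofReal (‖gradient φ x‖ ^ s + φ x ^ s) := by
  unfold cap
  exact (iInf_le _ φ).trans ((iInf_le _ hφ).trans ((iInf_le _ hφc).trans (iInf_le _ h)))

/-- `levelCutoff φ t` is admissible for K. Its gradient lives on the layer t/2 ≤ |φ| ≤ t, which is
what makes the later integration over t converge. -/
theorem cap_superlevel_le {n : ℕ} {s : ℝ} (hs : 0 < s) {M : ℝ}
    (hM : ∀ x, |deriv Real.smoothTransition x| ≤ M) {φ : Rn n → ℝ} (hφ : ContDiff ℝ ∞ φ)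
    (hφc : HasCompactSupport φ) {t : ℝ} (ht : 0 < t) {K : Set (Rn n)}
    (hK : ∀ x ∈ K, t ≤ |φ x|) :
    cap s K ≤ ∫⁻ x, ((if |φ x| ≤ t ∧ t ≤ 2 * |φ x| then
      ENNReal.ofReal ((3 * M * ‖fderiv ℝ φ x‖ / t) ^ s) else 0) +
        if t ≤ 2 * |φ x| then 1 else 0) := by
  have hM0 : 0 ≤ M := (abs_nonneg _).trans (hM 0)
  refine (cap_le (contDiff_levelCutoff (t := t) hφ) (hasCompactSupport_levelCutoff hφc) ?_).trans ?_
  · intro x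
    by_cases hx : x ∈ K
    · simp [hx, levelCutoff_eq_one ht (hK x hx)]
    · simp [hx, levelCutoff_nonneg]
  · refine lintegral_mono fun x => ?_
    rw [ENNReal.ofReal_add (by positivity) (Real.rpow_nonneg (levelCutoff_nonneg x) s),
      norm_gradient]
    refine add_le_add ?_ ?_
    · have h := norm_fderiv_levelCutoff_le hM (hφ.differentiable (by simp)) ht x
      split_ifs at h ⊢ with h'
      · exact ENNReal.ofReal_le_ofReal (Real.rpow_le_rpow (norm_nonneg _) h hs.le)
      · rw [le_antisymm h (norm_nonneg _), Real.zero_rpow hs.ne']; simp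
    · split_ifs with h'
      · rw [← ENNReal.ofReal_one]
        exact ENNReal.ofReal_le_ofReal
          (Real.rpow_le_one (levelCutoff_nonneg x) (levelCutoff_le_one x) hs.le)
      · rw [levelCutoff_eq_zero ht (not_le.1 h').le, Real.zero_rpow hs.ne']; simp

/-- The capacitary strong type inequality: a measure on `Ω` dominated by the capacity on compact
sets satisfies a trace inequality for smooth functions. -/
theorem exists_trace_inequality_smooth {n : ℕ} {s : ℝ} (hs : 1 < s) {Ω : Set (Rn n)}
    (hΩ : MeasurableSet Ω) {μ : Measure (Rn n)} [IsFiniteMeasure μ] (hμΩ : μ Ωᶜ = 0)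
    {C : ℝ≥0∞} (hC : C ≠ ⊤)
    (hμ : ∀ K : Set (Rn n), IsCompact K → K ⊆ Ω → μ K ≤ C * cap s K) :
    ∃ C' : ℝ≥0∞, C' ≠ ⊤ ∧ ∀ φ : Rn n → ℝ, ContDiff ℝ ∞ φ → HasCompactSupport φ →
      ∫⁻ x, ENNReal.ofReal (|φ x| ^ s) ∂μ ≤ C' * sobolevEnergy s φ := by
  obtain ⟨M, hM0, hM⟩ := exists_abs_deriv_smoothTransition_le
  have hs0 : 0 < s := by linarith
  -- The first summand comes from the gradient layers, the second from the zero-order term.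
  set B : ℝ≥0∞ := ENNReal.ofReal ((3 * M) ^ s) + ENNReal.ofReal (2 ^ s)
  refine ⟨ENNReal.ofReal s * (C * B), ?_, fun φ hφ hφc => ?_⟩
  · have : B ≠ ⊤ := by simp [B]
    exact ENNReal.mul_ne_top (by simp) (ENNReal.mul_ne_top hC this)
  have hφm : Measurable φ := hφ.continuous.measurable
  have hDm : Measurable fun x => ‖fderiv ℝ φ x‖ :=
    ((hφ.continuous_fderiv (by simp)).norm).measurable
  let J : ℝ → Rn n → ℝ≥0∞ := fun t x => (if |φ x| ≤ t ∧ t ≤ 2 * |φ x| then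
      ENNReal.ofReal ((3 * M * ‖fderiv ℝ φ x‖ / t) ^ s) else 0) +
        if t ≤ 2 * |φ x| then 1 else 0
  have hlevel : ∀ t, 0 < t → μ {x | t ≤ |φ x|} ≤ C * ∫⁻ x, J t x := by
    intro t ht
    have hm : MeasurableSet ({x | t ≤ |φ x|} ∩ Ω) :=
      (measurableSet_le measurable_const hφm.abs).inter hΩ
    have : μ {x | t ≤ |φ x|} = μ ({x | t ≤ |φ x|} ∩ Ω) := (measure_inter_conull hμΩ).symm
    -- The superlevel set inside Ω need not be compact, whereas the domination by capacity concerns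
    -- compact sets only; inner regularity of the finite measure bridges the gap.
    rw [this, hm.measure_eq_iSup_isCompact_of_ne_top (measure_ne_top _ _)]
    refine iSup_le fun K => iSup_le fun hK => iSup_le fun hKc => ?_
    exact (hμ K hKc fun x hx => (hK hx).2).trans
      (mul_le_mul_right (cap_superlevel_le hs0 hM hφ hφc ht fun x hx => (hK hx).1) _)
  rw [lintegral_rpow_eq_lintegral_meas_le_mul μ (ae_of_all _ fun x => abs_nonneg _)
    hφm.abs.aemeasurable hs0, mul_assoc]
  refine mul_le_mul_right ?_ _
  have hJm : Measurable (Function.uncurry fun (t : ℝ) (x : Rn n) =>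
      J t x * ENNReal.ofReal (t ^ (s - 1))) := by
    have h1 : Measurable fun z : ℝ × Rn n => |φ z.2| := (hφm.comp measurable_snd).abs
    refine Measurable.mul (Measurable.add (Measurable.ite ?_ ?_ measurable_const)
      (Measurable.ite ?_ measurable_const measurable_const)) ?_
    · exact (measurableSet_le h1 measurable_fst).inter
        (measurableSet_le measurable_fst (h1.const_mul 2))
    · exact ((((hDm.comp measurable_snd).const_mul (3 * M)).div
        measurable_fst).pow_const s).ennreal_ofReal
    · exact measurableSet_le measurable_fst (h1.const_mul 2)
    · exact (measurable_fst.pow_const (s - 1)).ennreal_ofReal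
  calc ∫⁻ t in Set.Ioi 0, μ {x | t ≤ |φ x|} * ENNReal.ofReal (t ^ (s - 1))
      ≤ ∫⁻ t in Set.Ioi 0, C * ∫⁻ x, J t x * ENNReal.ofReal (t ^ (s - 1)) := by
        refine setLIntegral_mono' measurableSet_Ioi fun t ht => ?_
        rw [lintegral_mul_const' _ _ (by simp), ← mul_assoc]
        gcongr
        exact hlevel t ht
    _ = C * ∫⁻ t in Set.Ioi 0, ∫⁻ x, J t x * ENNReal.ofReal (t ^ (s - 1)) := by
        rw [lintegral_const_mul' _ _ hC]
    _ = C * ∫⁻ x, ∫⁻ t in Set.Ioi 0, J t x * ENNReal.ofReal (t ^ (s - 1)) := by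
        rw [lintegral_lintegral_swap hJm.aemeasurable]
    _ ≤ C * ∫⁻ x, B * ENNReal.ofReal (‖fderiv ℝ φ x‖ ^ s + |φ x| ^ s) := by
        gcongr with x
        set y := |φ x|
        have hy : 0 ≤ y := abs_nonneg _
        set a := ‖fderiv ℝ φ x‖
        have ha : 0 ≤ a := norm_nonneg _
        -- For fixed x the gradient term is (3Ma)^s dt/t over [y, 2y]; bounding 1/t by 1/y on this
        -- interval of length y gives at most (3Ma)^s. The zero-order term is at most (2y)^(s-1)
        -- over (0, 2y] and gives (2y)^s.
        have hpt : ∀ t ∈ Set.Ioi (0 : ℝ), J t x * ENNReal.ofReal (t ^ (s - 1)) ≤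
            (Set.Icc y (2 * y)).indicator (fun _ => ENNReal.ofReal ((3 * M * a) ^ s / y)) t +
            (Set.Ioc 0 (2 * y)).indicator (fun _ => ENNReal.ofReal ((2 * y) ^ (s - 1))) t := by
          intro t ht
          have ht : 0 < t := ht
          rw [add_mul]
          refine add_le_add ?_ ?_
          · by_cases h : y ≤ t ∧ t ≤ 2 * y
            · have hy' : 0 < y := by linarith [h.2]
              rw [Set.indicator_of_mem (by exact h), if_pos h, ← ENNReal.ofReal_mul (by positivity)]
              refine ENNReal.ofReal_le_ofReal ?_
              rw [Real.div_rpow (by positivity) ht.le, div_mul_eq_mul_div, Real.rpow_sub_one ht.ne']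
              rw [show (3 * M * a) ^ s * (t ^ s / t) / t ^ s = (3 * M * a) ^ s / t by
                have := (Real.rpow_pos_of_pos ht s).ne'
                field_simp]
              exact div_le_div_of_nonneg_left (by positivity) hy' h.1
            · rw [if_neg h]; simp
          · by_cases h : t ≤ 2 * y
            · rw [Set.indicator_of_mem (by exact ⟨ht, h⟩), if_pos h, one_mul]
              exact ENNReal.ofReal_le_ofReal (Real.rpow_le_rpow ht.le h (by linarith))
            · rw [if_neg h]; simp
        refine (setLIntegral_mono' measurableSet_Ioi hpt).trans ?_
        refine (setLIntegral_le_lintegral _ _).trans ?_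
        rw [lintegral_add_left (measurable_const.indicator measurableSet_Icc),
          lintegral_indicator_const measurableSet_Icc,
          lintegral_indicator_const measurableSet_Ioc, Real.volume_Icc, Real.volume_Ioc,
          add_mul]
        refine add_le_add ?_ ?_
        · rw [← ENNReal.ofReal_mul (by positivity), ← ENNReal.ofReal_mul (by positivity)]
          refine ENNReal.ofReal_le_ofReal ?_
          rw [Real.mul_rpow (by positivity) ha]
          have h1 : (3 * M) ^ s * a ^ s / y * (2 * y - y) ≤ (3 * M) ^ s * a ^ s := by
            rcases hy.eq_or_lt with h | h
            · rw [← h]; simp; positivity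
            · apply le_of_eq; field_simp; ring
          refine h1.trans ?_
          gcongr
          have := Real.rpow_nonneg hy s
          linarith
        · rw [← ENNReal.ofReal_mul (by positivity), ← ENNReal.ofReal_mul (by positivity)]
          refine ENNReal.ofReal_le_ofReal ?_
          rw [sub_zero, ← Real.rpow_add_one' (by positivity) (by linarith), sub_add_cancel,
            Real.mul_rpow (by norm_num) hy]
          gcongr
          have := Real.rpow_nonneg ha s
          linarith
    _ = C * B * sobolevEnergy s φ := by
        rw [lintegral_const_mul' _ _ (by simp [B]), mul_assoc, sobolevEnergy]

/-! ### From smooth to C¹ functions, and the Poincaré inequality -/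

/-- Compactly supported `C¹` functions are uniform limits, together with their derivatives, of
smooth functions supported in a common compact set. -/
theorem exists_smooth_approx {n : ℕ} {φ : Rn n → ℝ} (hφ : ContDiff ℝ 1 φ)
    (hφc : HasCompactSupport φ) {ε ρ : ℝ} (hε : 0 < ε) (hρ : 0 < ρ) :
    ∃ ψ : Rn n → ℝ, ContDiff ℝ ∞ ψ ∧ tsupport ψ ⊆ Metric.cthickening ρ (tsupport φ) ∧
      (∀ x, |ψ x - φ x| ≤ ε) ∧ ∀ x, ‖fderiv ℝ ψ x - fderiv ℝ φ x‖ ≤ ε := by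
  have hDc : Continuous (fderiv ℝ φ) := hφ.continuous_fderiv one_ne_zero
  have hu1 : UniformContinuous φ := hφc.uniformContinuous_of_continuous hφ.continuous
  have hu2 : UniformContinuous (fderiv ℝ φ) :=
    (hφc.fderiv ℝ).uniformContinuous_of_continuous hDc
  obtain ⟨δ₁, hδ₁, h1⟩ := Metric.uniformContinuous_iff.1 hu1 ε hε
  obtain ⟨δ₂, hδ₂, h2⟩ := Metric.uniformContinuous_iff.1 hu2 ε hε
  set δ := min ρ (min δ₁ δ₂)
  have hδ : 0 < δ := by positivity
  let b : ContDiffBump (0 : Rn n) := ⟨δ / 2, δ, by positivity, by linarith⟩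
  have hloc : LocallyIntegrable (b.normed volume) volume :=
    b.continuous_normed.locallyIntegrable
  refine ⟨convolution (b.normed volume) φ (ContinuousLinearMap.lsmul ℝ ℝ) volume, ?_, ?_, ?_, ?_⟩
  · exact b.hasCompactSupport_normed.contDiff_convolution_left _ b.contDiff_normed
      hφ.continuous.locallyIntegrable
  · refine closure_minimal ?_ Metric.isClosed_cthickening
    refine (support_convolution_subset _).trans ?_
    rintro _ ⟨y, hy, z, hz, rfl⟩
    rw [b.support_normed_eq] at hy
    refine Metric.mem_cthickening_of_dist_le _ z _ _ (subset_closure hz) ?_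
    have : ‖y‖ < δ := by simpa using hy
    simpa using (this.le.trans (min_le_left _ _))
  · intro x
    rw [← Real.dist_eq]
    refine ContDiffBump.dist_normed_convolution_le hφ.continuous.aestronglyMeasurable ?_
    intro y hy
    exact (h1 (lt_of_lt_of_le hy ((min_le_right _ _).trans (min_le_left _ _)))).le
  · intro x
    rw [(hφc.hasFDerivAt_convolution_right _ hloc hφ x).fderiv, ← dist_eq_norm]
    have e : convolution (b.normed volume) (fderiv ℝ φ)
        ((ContinuousLinearMap.lsmul ℝ ℝ : ℝ →L[ℝ] ℝ →L[ℝ] ℝ).precompR (Rn n)) volume x =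
        convolution (b.normed volume) (fderiv ℝ φ) (ContinuousLinearMap.lsmul ℝ ℝ) volume x := by
      refine integral_congr_ae (ae_of_all _ fun t => ?_)
      ext v
      simp
    rw [e]
    refine ContDiffBump.dist_normed_convolution_le hDc.aestronglyMeasurable ?_
    intro y hy
    exact (h2 (lt_of_lt_of_le hy ((min_le_right _ _).trans (min_le_right _ _)))).le

/-- Mollification, with Fatou's lemma on the left and dominated convergence on the right. The
extension to C¹ is needed because the functions ψ h^(1-s) used later are only C¹. -/
theorem trace_inequality_of_smooth {n : ℕ} {s : ℝ} (hs : 0 < s) {μ : Measure (Rn n)} {C : ℝ≥0∞}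
    (hC : C ≠ ⊤)
    (h : ∀ φ : Rn n → ℝ, ContDiff ℝ ∞ φ → HasCompactSupport φ →
      ∫⁻ x, ENNReal.ofReal (|φ x| ^ s) ∂μ ≤ C * sobolevEnergy s φ)
    {φ : Rn n → ℝ} (hφ : ContDiff ℝ 1 φ) (hφc : HasCompactSupport φ) :
    ∫⁻ x, ENNReal.ofReal (|φ x| ^ s) ∂μ ≤ C * sobolevEnergy s φ := by
  have hε : ∀ k : ℕ, (0 : ℝ) < 1 / ((k : ℝ) + 1) := fun k => by positivity
  choose ψ hψ hψs hψ0 hψ1 using fun k : ℕ => exists_smooth_approx hφ hφc (hε k) one_pos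
  have hK : IsCompact (Metric.cthickening 1 (tsupport φ)) := hφc.isCompact.cthickening
  have hψc : ∀ k, HasCompactSupport (ψ k) := fun k =>
    hK.of_isClosed_subset (isClosed_tsupport _) (hψs k)
  have hDc : Continuous (fderiv ℝ φ) := hφ.continuous_fderiv one_ne_zero
  obtain ⟨B, hB⟩ := hφ.continuous.bounded_above_of_compact_support hφc
  obtain ⟨B', hB'⟩ := hDc.bounded_above_of_compact_support (hφc.fderiv ℝ)
  have ht0 : ∀ x, Tendsto (fun k => ψ k x) atTop (𝓝 (φ x)) := fun x =>
    tendsto_iff_norm_sub_tendsto_zero.2 <|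
      squeeze_zero (fun _ => norm_nonneg _) (fun k => hψ0 k x)
        tendsto_one_div_add_atTop_nhds_zero_nat
  have ht1 : ∀ x, Tendsto (fun k => fderiv ℝ (ψ k) x) atTop (𝓝 (fderiv ℝ φ x)) := fun x =>
    tendsto_iff_norm_sub_tendsto_zero.2 <|
      squeeze_zero (fun _ => norm_nonneg _) (fun k => hψ1 k x)
        tendsto_one_div_add_atTop_nhds_zero_nat
  have hle : ∀ k : ℕ, 1 / ((k : ℝ) + 1) ≤ 1 := fun k => by
    rw [div_le_one (by positivity)]; linarith [k.cast_nonneg (α := ℝ)]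
  have hE : Tendsto (fun k => sobolevEnergy s (ψ k)) atTop (𝓝 (sobolevEnergy s φ)) := by
    refine tendsto_lintegral_of_dominated_convergence
      ((Metric.cthickening 1 (tsupport φ)).indicator
        fun _ => ENNReal.ofReal ((1 + B') ^ s + (1 + B) ^ s)) ?_ ?_ ?_ ?_
    · intro k
      have h1 := ((hψ k).continuous_fderiv (by simp)).norm.measurable
      have h2 := (hψ k).continuous.measurable
      exact ((h1.pow_const s).add (h2.abs.pow_const s)).ennreal_ofReal
    · intro k
      refine ae_of_all _ fun x => ?_
      by_cases hx : x ∈ Metric.cthickening 1 (tsupport φ)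
      · rw [Set.indicator_of_mem hx]
        refine ENNReal.ofReal_le_ofReal ?_
        have h1 : ‖fderiv ℝ (ψ k) x‖ ≤ 1 + B' := by
          have := norm_add_le (fderiv ℝ (ψ k) x - fderiv ℝ φ x) (fderiv ℝ φ x)
          rw [sub_add_cancel] at this
          linarith [hψ1 k x, hB' x, hle k]
        have h2 : |ψ k x| ≤ 1 + B := by
          have := abs_add_le (ψ k x - φ x) (φ x)
          rw [sub_add_cancel] at this
          have h3 := hB x
          rw [Real.norm_eq_abs] at h3
          linarith [hψ0 k x, hle k]
        exact add_le_add (Real.rpow_le_rpow (norm_nonneg _) h1 hs.le)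
          (Real.rpow_le_rpow (abs_nonneg _) h2 hs.le)
      · have h0 : x ∉ tsupport (ψ k) := fun h => hx (hψs k h)
        have h1 : ψ k x = 0 := image_eq_zero_of_notMem_tsupport h0
        have h2 : fderiv ℝ (ψ k) x = 0 := fderiv_of_notMem_tsupport ℝ h0
        simp [h1, h2, Real.zero_rpow hs.ne']
    · rw [lintegral_indicator_const hK.measurableSet]
      exact ENNReal.mul_ne_top (by simp) hK.measure_ne_top
    · refine ae_of_all _ fun x => ENNReal.tendsto_ofReal ?_
      exact ((ht1 x).norm.rpow_const (Or.inr hs.le)).add ((ht0 x).abs.rpow_const (Or.inr hs.le))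
  calc ∫⁻ x, ENNReal.ofReal (|φ x| ^ s) ∂μ
      = ∫⁻ x, liminf (fun k => ENNReal.ofReal (|ψ k x| ^ s)) atTop ∂μ := by
        refine lintegral_congr fun x => ?_
        exact (ENNReal.tendsto_ofReal ((ht0 x).abs.rpow_const (Or.inr hs.le))).liminf_eq.symm
    _ ≤ liminf (fun k => ∫⁻ x, ENNReal.ofReal (|ψ k x| ^ s) ∂μ) atTop :=
        lintegral_liminf_le fun k =>
          ((hψ k).continuous.measurable.abs.pow_const s).ennreal_ofReal
    _ ≤ liminf (fun k => C * sobolevEnergy s (ψ k)) atTop :=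
        liminf_le_liminf (Eventually.of_forall fun k => h _ (hψ k) (hψc k))
    _ = C * sobolevEnergy s φ := (ENNReal.Tendsto.const_mul hE (Or.inr hC)).liminf_eq

theorem integrable_rpow_of_compactSupport {n : ℕ} {s : ℝ} (hs : 0 < s) {μ : Measure (Rn n)}
    [IsFiniteMeasureOnCompacts μ] {F : Type*} [NormedAddCommGroup F] {f : Rn n → F}
    (hf : Continuous f) (hfc : HasCompactSupport f) : Integrable (fun x => ‖f x‖ ^ s) μ :=
  (hf.norm.rpow_const fun _ => Or.inr hs.le).integrable_of_hasCompactSupport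
    (hfc.comp_left (g := fun y => ‖y‖ ^ s) (by simp [Real.zero_rpow hs.ne']))

/-- The Poincaré inequality for `C¹` functions supported in a ball. -/
theorem poincare_inequality {n : ℕ} (i : Fin n) {s R : ℝ} (hs : 1 < s) (hR : 0 ≤ R)
    {φ : Rn n → ℝ} (hφ : ContDiff ℝ 1 φ) (hφs : tsupport φ ⊆ Metric.closedBall 0 R) :
    ∫ x, |φ x| ^ s ≤ (R * s) ^ s * ∫ x, ‖fderiv ℝ φ x‖ ^ s := by
  have hs0 : 0 < s := by linarith
  have hφc : HasCompactSupport φ :=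
    (isCompact_closedBall (0 : Rn n) R).of_isClosed_subset (isClosed_tsupport _) hφs
  have hDc : Continuous (fderiv ℝ φ) := hφ.continuous_fderiv one_ne_zero
  let g : Rn n → ℝ := fun x => |φ x| ^ s
  have hg : ContDiff ℝ 1 g := hφ.norm_rpow hs
  have hgc : HasCompactSupport g :=
    hφc.comp_left (g := fun y => |y| ^ s) (by simp [Real.zero_rpow hs0.ne'])
  let v : Rn n := EuclideanSpace.single i 1
  let f : Rn n →L[ℝ] ℝ := EuclideanSpace.proj i
  have hv : f v = 1 := by simp [f, v]
  have hi1 : Integrable (fun x => |φ x| ^ s) (volume : Measure (Rn n)) :=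
    integrable_rpow_of_compactSupport hs0 hφ.continuous hφc
  have hi2 : Integrable (fun x => ‖fderiv ℝ φ x‖ ^ s) (volume : Measure (Rn n)) :=
    integrable_rpow_of_compactSupport hs0 hDc (hφc.fderiv ℝ)
  have hgD : Continuous fun x => fderiv ℝ g x v :=
    (hg.continuous_fderiv one_ne_zero).clm_apply continuous_const
  have hgDc : HasCompactSupport fun x => fderiv ℝ g x v :=
    (hgc.fderiv ℝ).comp_left (g := fun L : Rn n →L[ℝ] ℝ => L v) (by simp)
  -- Integration by parts of |φ|^s against the coordinate function x_i, whose derivative in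
  -- direction i is 1 and which is bounded by R on the ball.
  have hpart : ∫ x, f x * fderiv ℝ g x v = - ∫ x, fderiv ℝ f x v * g x := by
    refine integral_mul_fderiv_eq_neg_fderiv_mul_of_integrable ?_ ?_ ?_
      (fun x _ => f.differentiableAt) (fun x _ => hg.differentiable one_ne_zero x)
    · simpa [hv, g] using hi1
    · exact (f.continuous.mul hgD).integrable_of_hasCompactSupport hgDc.mul_left
    · exact (f.continuous.mul hg.continuous).integrable_of_hasCompactSupport hgc.mul_left
  simp only [ContinuousLinearMap.fderiv, hv, one_mul] at hpart
  have hconj : (s / (s - 1)).HolderConjugate s := (Real.HolderConjugate.conjExponent hs).symm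
  have hpt : ∀ x, -(f x * fderiv ℝ g x v) ≤
      (1 - 1 / s) * |φ x| ^ s + (R * s) ^ s / s * ‖fderiv ℝ φ x‖ ^ s := by
    intro x
    by_cases hx : x ∈ Metric.closedBall (0 : Rn n) R
    · have hx' : ‖x‖ ≤ R := by simpa using hx
      have h1 : |f x| ≤ R := by
        have := PiLp.norm_apply_le x i
        exact this.trans hx'
      have h2 : |fderiv ℝ g x v| ≤ s * |φ x| ^ (s - 1) * ‖fderiv ℝ φ x‖ := by
        refine ((fderiv ℝ g x).le_opNorm v).trans ?_
        have : ‖v‖ = 1 := by simp [v]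
        rw [this, mul_one]
        exact norm_fderiv_norm_rpow_le (hφ.differentiable one_ne_zero) hs
      have h3 : -(f x * fderiv ℝ g x v) ≤ |φ x| ^ (s - 1) * (R * s * ‖fderiv ℝ φ x‖) := by
        calc -(f x * fderiv ℝ g x v) ≤ |f x * fderiv ℝ g x v| := neg_le_abs _
          _ = |f x| * |fderiv ℝ g x v| := abs_mul _ _
          _ ≤ R * (s * |φ x| ^ (s - 1) * ‖fderiv ℝ φ x‖) := by gcongr
          _ = _ := by ring
      -- Young's inequality leaves the factor 1 - 1/s in front of |φ|^s, which is absorbed on the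
      -- left after integration.
      refine h3.trans ((Real.young_inequality_of_nonneg (by positivity) (by positivity)
        hconj).trans (le_of_eq ?_))
      rw [← Real.rpow_mul (abs_nonneg _), mul_div_cancel₀ _ (by linarith : s - 1 ≠ 0),
        Real.mul_rpow (by positivity) (norm_nonneg _)]
      field_simp
    · have h0 : x ∉ tsupport φ := fun h => hx (hφs h)
      have h1 : fderiv ℝ g x = 0 := by
        refine fderiv_of_notMem_tsupport ℝ fun h => h0 ?_
        refine tsupport_comp_subset (g := fun y => |y| ^ s) (by simp [Real.zero_rpow hs0.ne']) φ h
      rw [h1]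
      have : 0 ≤ 1 - 1 / s := by
        rw [sub_nonneg, div_le_one hs0]; exact hs.le
      simp only [_root_.zero_apply, mul_zero, neg_zero]
      positivity
  have hfin : ∫ x, |φ x| ^ s ≤ (1 - 1 / s) * (∫ x, |φ x| ^ s) +
      (R * s) ^ s / s * ∫ x, ‖fderiv ℝ φ x‖ ^ s := by
    calc ∫ x, |φ x| ^ s = ∫ x, -(f x * fderiv ℝ g x v) := by
          rw [integral_neg, hpart, neg_neg]
      _ ≤ ∫ x, ((1 - 1 / s) * |φ x| ^ s + (R * s) ^ s / s * ‖fderiv ℝ φ x‖ ^ s) := by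
          refine integral_mono ?_ ((hi1.const_mul _).add (hi2.const_mul _)) hpt
          exact ((f.continuous.mul hgD).integrable_of_hasCompactSupport hgDc.mul_left).neg
      _ = _ := by
          rw [integral_add (hi1.const_mul _) (hi2.const_mul _), integral_const_mul,
            integral_const_mul]
  have : 1 / s * ∫ x, |φ x| ^ s ≤ 1 / s * ((R * s) ^ s * ∫ x, ‖fderiv ℝ φ x‖ ^ s) := by
    have e : 1 / s * ((R * s) ^ s * ∫ x, ‖fderiv ℝ φ x‖ ^ s) =
      (R * s) ^ s / s * ∫ x, ‖fderiv ℝ φ x‖ ^ s := by ring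
    rw [e]; linarith
  exact le_of_mul_le_mul_left this (by positivity)

/-- The trace inequality in terms of the gradient alone, for `C¹` functions supported in a ball. -/
theorem exists_trace_inequality {n : ℕ} (i : Fin n) {s R : ℝ} (hs : 1 < s) (hR : 0 ≤ R)
    {Ω : Set (Rn n)} (hΩ : MeasurableSet Ω) {μ : Measure (Rn n)} [IsFiniteMeasure μ]
    (hμΩ : μ Ωᶜ = 0) {C : ℝ≥0∞} (hC : C ≠ ⊤)
    (hμ : ∀ K : Set (Rn n), IsCompact K → K ⊆ Ω → μ K ≤ C * cap s K) :
    ∃ C' : ℝ, 0 ≤ C' ∧ ∀ φ : Rn n → ℝ, ContDiff ℝ 1 φ → tsupport φ ⊆ Metric.closedBall 0 R →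
      ∫ x, |φ x| ^ s ∂μ ≤ C' * ∫ x, ‖fderiv ℝ φ x‖ ^ s := by
  obtain ⟨C₁, hC₁, h⟩ := exists_trace_inequality_smooth hs hΩ hμΩ hC hμ
  have hs0 : 0 < s := by linarith
  refine ⟨C₁.toReal * (1 + (R * s) ^ s), by positivity, fun φ hφ hφs => ?_⟩
  have hφc : HasCompactSupport φ :=
    (isCompact_closedBall (0 : Rn n) R).of_isClosed_subset (isClosed_tsupport _) hφs
  have hDc : Continuous (fderiv ℝ φ) := hφ.continuous_fderiv one_ne_zero
  have h1 := trace_inequality_of_smooth hs0 hC₁ h hφ hφc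
  have hi0 : Integrable (fun x => |φ x| ^ s) μ :=
    integrable_rpow_of_compactSupport hs0 hφ.continuous hφc
  have hi1 : Integrable (fun x => |φ x| ^ s) (volume : Measure (Rn n)) :=
    integrable_rpow_of_compactSupport hs0 hφ.continuous hφc
  have hi2 : Integrable (fun x => ‖fderiv ℝ φ x‖ ^ s) (volume : Measure (Rn n)) :=
    integrable_rpow_of_compactSupport hs0 hDc (hφc.fderiv ℝ)
  have hi3 : Integrable (fun x => ‖fderiv ℝ φ x‖ ^ s + |φ x| ^ s)
      (volume : Measure (Rn n)) := hi2.add hi1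
  rw [sobolevEnergy,
    ← ofReal_integral_eq_lintegral_ofReal hi3 (ae_of_all _ fun x => by positivity),
    ← ofReal_integral_eq_lintegral_ofReal hi0 (ae_of_all _ fun x => by positivity),
    ← ENNReal.ofReal_toReal hC₁, ← ENNReal.ofReal_mul (by positivity)] at h1
  have hpos : 0 ≤ ∫ x, (‖fderiv ℝ φ x‖ ^ s + |φ x| ^ s) :=
    integral_nonneg fun x => by positivity
  have h2 := (ENNReal.ofReal_le_ofReal_iff (by positivity)).1 h1
  rw [integral_add hi2 hi1] at h2
  refine h2.trans ?_
  rw [mul_assoc]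
  gcongr
  have := poincare_inequality i hs hR hφ hφs
  linarith

/-! ### Barriers and the hidden convexity of their energy -/

theorem norm_convex_comb_rpow_le {F : Type*} [NormedAddCommGroup F] [NormedSpace ℝ F] {s : ℝ}
    (hs : 1 ≤ s) {l : ℝ} (h0 : 0 ≤ l) (h1 : l ≤ 1) (X Y : F) :
    ‖(1 - l) • X + l • Y‖ ^ s ≤ (1 - l) * ‖X‖ ^ s + l * ‖Y‖ ^ s := by
  have hl : 0 ≤ 1 - l := by linarith
  have h : ‖(1 - l) • X + l • Y‖ ≤ (1 - l) * ‖X‖ + l * ‖Y‖ := by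
    refine (norm_add_le _ _).trans (le_of_eq ?_)
    rw [norm_smul, norm_smul, Real.norm_of_nonneg hl, Real.norm_of_nonneg h0]
  refine (Real.rpow_le_rpow (norm_nonneg _) h (by linarith)).trans ?_
  simpa using (convexOn_rpow hs).2 (norm_nonneg X) (norm_nonneg Y) hl h0 (by ring)

/-- Joint convexity of `(a, α) ↦ ‖a‖^s α^(1-s)`. -/
theorem norm_add_rpow_mul_rpow_le {F : Type*} [NormedAddCommGroup F] [NormedSpace ℝ F] {s : ℝ}
    (hs : 1 ≤ s) (a b : F) {α β : ℝ} (hα : 0 < α) (hβ : 0 < β) :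
    ‖a + b‖ ^ s * (α + β) ^ (1 - s) ≤ ‖a‖ ^ s * α ^ (1 - s) + ‖b‖ ^ s * β ^ (1 - s) := by
  have hαβ : 0 < α + β := by positivity
  -- The expression is the perspective γ‖c/γ‖^s of the convex function ‖·‖^s, so joint convexity
  -- reduces to convexity of the latter with weights α/(α+β) and β/(α+β).
  have key : ∀ (c : F) {γ : ℝ}, 0 < γ → ‖c‖ ^ s * γ ^ (1 - s) = γ * ‖γ⁻¹ • c‖ ^ s := by
    intro c γ hγ
    rw [norm_smul, norm_inv, Real.norm_of_nonneg hγ.le, Real.mul_rpow (by positivity)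
      (norm_nonneg _), Real.inv_rpow hγ.le, Real.rpow_sub hγ, Real.rpow_one]
    ring
  rw [key _ hαβ, key _ hα, key _ hβ]
  have h := norm_convex_comb_rpow_le hs (l := β / (α + β)) (by positivity)
    ((div_le_one hαβ).2 (by linarith)) (α⁻¹ • a) (β⁻¹ • b)
  have e1 : 1 - β / (α + β) = α / (α + β) := by field_simp; ring
  have e : (1 - β / (α + β)) • (α⁻¹ • a) + (β / (α + β)) • (β⁻¹ • b) = (α + β)⁻¹ • (a + b) := by
    rw [e1, smul_smul, smul_smul, smul_add]
    congr 2 <;> field_simp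
  rw [e, e1] at h
  calc (α + β) * ‖(α + β)⁻¹ • (a + b)‖ ^ s
      ≤ (α + β) * (α / (α + β) * ‖α⁻¹ • a‖ ^ s + β / (α + β) * ‖β⁻¹ • b‖ ^ s) := by gcongr
    _ = _ := by field_simp

theorem add_rpow_le_two_rpow_mul {s a b : ℝ} (hs : 0 ≤ s) (ha : 0 ≤ a) (hb : 0 ≤ b) :
    (a + b) ^ s ≤ 2 ^ s * (a ^ s + b ^ s) := by
  have ha' := Real.rpow_nonneg ha s
  have hb' := Real.rpow_nonneg hb s
  have h : (a + b) ^ s ≤ (2 * max a b) ^ s :=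
    Real.rpow_le_rpow (by positivity) (by linarith [le_max_left a b, le_max_right a b]) hs
  refine h.trans ?_
  rw [Real.mul_rpow (by norm_num) (by positivity)]
  gcongr
  rcases max_cases a b with ⟨h, _⟩ | ⟨h, _⟩ <;> rw [h] <;> linarith

/-- `v` is a positive `C¹` function that is constant, equal to `d`, outside the ball of
radius `R`. -/
structure IsBarrier {n : ℕ} (R : ℝ) (v : Rn n → ℝ) (d : ℝ) : Prop where
  contDiff : ContDiff ℝ 1 v
  pos : ∀ x, 0 < v x
  const_pos : 0 < d
  eq_const : ∀ x, x ∉ Metric.closedBall (0 : Rn n) R → v x = d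

/-- The homogeneous energy of a barrier. -/
noncomputable def barrierEnergy {n : ℕ} (s : ℝ) (v : Rn n → ℝ) (d : ℝ) : ℝ :=
  (∫ x, ‖fderiv ℝ v x‖ ^ s) + d ^ s

theorem isCompact_tsupport_of_subset_closedBall {n : ℕ} {R : ℝ} {F : Type*} [Zero F]
    {φ : Rn n → F} (h : tsupport φ ⊆ Metric.closedBall 0 R) : HasCompactSupport φ :=
  (isCompact_closedBall (0 : Rn n) R).of_isClosed_subset (isClosed_tsupport _) h

theorem tsupport_subset_closedBall {n : ℕ} {R : ℝ} {F : Type*} [Zero F] {φ : Rn n → F}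
    (h : ∀ x, x ∉ Metric.closedBall (0 : Rn n) R → φ x = 0) :
    tsupport φ ⊆ Metric.closedBall 0 R :=
  closure_minimal (fun x hx => by_contra fun hx' => hx (h x hx')) Metric.isClosed_closedBall

theorem eq_zero_of_notMem_closedBall {n : ℕ} {R : ℝ} {F : Type*} [Zero F] {φ : Rn n → F}
    (h : tsupport φ ⊆ Metric.closedBall 0 R) {x : Rn n}
    (hx : x ∉ Metric.closedBall (0 : Rn n) R) : φ x = 0 :=
  image_eq_zero_of_notMem_tsupport fun h' => hx (h h')

namespace IsBarrier

variable {n : ℕ} {R d s : ℝ} {v : Rn n → ℝ}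

theorem tsupport_sub_const (h : IsBarrier R v d) :
    tsupport (fun x => v x - d) ⊆ Metric.closedBall 0 R :=
  tsupport_subset_closedBall fun x hx => by rw [h.eq_const x hx, sub_self]

theorem tsupport_fderiv (h : IsBarrier R v d) :
    tsupport (fderiv ℝ v) ⊆ Metric.closedBall 0 R := by
  have : fderiv ℝ v = fderiv ℝ (fun x => v x - d) := by
    ext1 x; rw [fderiv_sub_const]
  rw [this]
  exact (tsupport_fderiv_subset ℝ).trans h.tsupport_sub_const

theorem continuous_fderiv (h : IsBarrier R v d) : Continuous (fderiv ℝ v) :=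
  h.contDiff.continuous_fderiv one_ne_zero

theorem differentiable (h : IsBarrier R v d) : Differentiable ℝ v :=
  h.contDiff.differentiable one_ne_zero

theorem integrable (h : IsBarrier R v d) (hs : 0 < s) :
    Integrable (fun x => ‖fderiv ℝ v x‖ ^ s) volume :=
  integrable_rpow_of_compactSupport hs h.continuous_fderiv
    (isCompact_tsupport_of_subset_closedBall h.tsupport_fderiv)

theorem energy_pos (h : IsBarrier R v d) : 0 < barrierEnergy s v d :=
  add_pos_of_nonneg_of_pos (integral_nonneg fun x => by positivity)
    (Real.rpow_pos_of_pos h.const_pos s)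

/-- Compactness inside the ball, constancy outside. The positive lower bound makes all powers of v
bounded, negative ones included. -/
theorem exists_bounds (h : IsBarrier R v d) :
    ∃ m M : ℝ, 0 < m ∧ ∀ x, m ≤ v x ∧ v x ≤ M := by
  rcases (Metric.closedBall (0 : Rn n) R).eq_empty_or_nonempty with he | hne
  · exact ⟨d, d, h.const_pos, fun x => by rw [h.eq_const x (by simp [he])]; simp⟩
  obtain ⟨a, _, ha⟩ := (isCompact_closedBall (0 : Rn n) R).exists_isMinOn hne
    h.contDiff.continuous.continuousOn
  obtain ⟨b, _, hb⟩ := (isCompact_closedBall (0 : Rn n) R).exists_isMaxOn hne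
    h.contDiff.continuous.continuousOn
  refine ⟨min (v a) d, max (v b) d, lt_min (h.pos a) h.const_pos, fun x => ?_⟩
  by_cases hx : x ∈ Metric.closedBall (0 : Rn n) R
  · exact ⟨(min_le_left _ _).trans (ha hx), le_trans (hb hx) (le_max_left _ _)⟩
  · rw [h.eq_const x hx]
    exact ⟨min_le_right _ _, le_max_right _ _⟩

theorem const (hd : 0 < d) : IsBarrier (n := n) R (fun _ => d) d :=
  ⟨contDiff_const, fun _ => hd, hd, fun _ _ => rfl⟩

theorem energy_const (hs : 0 < s) : barrierEnergy (n := n) s (fun _ => d) d = d ^ s := by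
  simp [barrierEnergy, Real.zero_rpow hs.ne']

theorem const_mul (h : IsBarrier R v d) {c : ℝ} (hc : 0 < c) :
    IsBarrier R (fun x => c * v x) (c * d) :=
  ⟨contDiff_const.mul h.contDiff, fun x => mul_pos hc (h.pos x), mul_pos hc h.const_pos,
    fun x hx => by rw [h.eq_const x hx]⟩

theorem energy_const_mul (h : IsBarrier R v d) {c : ℝ} (hc : 0 < c) :
    barrierEnergy s (fun x => c * v x) (c * d) = c ^ s * barrierEnergy s v d := by
  have : ∀ x, ‖fderiv ℝ (fun x => c * v x) x‖ ^ s = c ^ s * ‖fderiv ℝ v x‖ ^ s := by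
    intro x
    rw [fderiv_const_mul (h.differentiable x), norm_smul, Real.norm_of_nonneg hc.le,
      Real.mul_rpow hc.le (norm_nonneg _)]
  simp only [barrierEnergy, this]
  rw [integral_const_mul, Real.mul_rpow hc.le h.const_pos.le]
  ring

theorem add_of_nonneg (h : IsBarrier R v d) {η : Rn n → ℝ} (hη : ContDiff ℝ 1 η)
    (h0 : ∀ x, 0 ≤ η x) (hηs : tsupport η ⊆ Metric.closedBall 0 R) :
    IsBarrier R (fun x => v x + η x) d :=
  ⟨h.contDiff.add hη, fun x => add_pos_of_pos_of_nonneg (h.pos x) (h0 x), h.const_pos,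
    fun x hx => by rw [h.eq_const x hx, eq_zero_of_notMem_closedBall hηs hx, add_zero]⟩

variable {v₁ v₂ : Rn n → ℝ} {d₁ d₂ : ℝ}

theorem rpow_add_rpow (h₁ : IsBarrier R v₁ d₁) (h₂ : IsBarrier R v₂ d₂) :
    IsBarrier R (fun x => (v₁ x ^ s + v₂ x ^ s) ^ (1 / s)) ((d₁ ^ s + d₂ ^ s) ^ (1 / s)) := by
  have hp : ∀ x, 0 < v₁ x ^ s + v₂ x ^ s := fun x =>
    add_pos (Real.rpow_pos_of_pos (h₁.pos x) s) (Real.rpow_pos_of_pos (h₂.pos x) s)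
  refine ⟨?_, fun x => Real.rpow_pos_of_pos (hp x) _, ?_, fun x hx => ?_⟩
  · exact ((h₁.contDiff.rpow_const_of_ne fun x => (h₁.pos x).ne').add
      (h₂.contDiff.rpow_const_of_ne fun x => (h₂.pos x).ne')).rpow_const_of_ne fun x => (hp x).ne'
  · exact Real.rpow_pos_of_pos
      (add_pos (Real.rpow_pos_of_pos h₁.const_pos s) (Real.rpow_pos_of_pos h₂.const_pos s)) _
  · rw [h₁.eq_const x hx, h₂.eq_const x hx]

/-- Hidden convexity of the energy. -/
theorem energy_rpow_add_rpow_le (hs : 1 < s) (h₁ : IsBarrier R v₁ d₁) (h₂ : IsBarrier R v₂ d₂) :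
    barrierEnergy s (fun x => (v₁ x ^ s + v₂ x ^ s) ^ (1 / s)) ((d₁ ^ s + d₂ ^ s) ^ (1 / s)) ≤
      barrierEnergy s v₁ d₁ + barrierEnergy s v₂ d₂ := by
  have hs0 : 0 < s := by linarith
  have h := rpow_add_rpow (s := s) h₁ h₂
  have hpt : ∀ x, ‖fderiv ℝ (fun x => (v₁ x ^ s + v₂ x ^ s) ^ (1 / s)) x‖ ^ s ≤
      ‖fderiv ℝ v₁ x‖ ^ s + ‖fderiv ℝ v₂ x‖ ^ s := by
    intro x
    have hp1 := Real.rpow_pos_of_pos (h₁.pos x) s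
    have hp2 := Real.rpow_pos_of_pos (h₂.pos x) s
    set w := v₁ x ^ s + v₂ x ^ s with hw
    have hwp : 0 < w := by positivity
    have e : fderiv ℝ (fun x => (v₁ x ^ s + v₂ x ^ s) ^ (1 / s)) x = (w ^ (1 / s - 1)) •
        (v₁ x ^ (s - 1) • fderiv ℝ v₁ x + v₂ x ^ (s - 1) • fderiv ℝ v₂ x) := by
      have a1 := (h₁.differentiable x).hasFDerivAt.rpow_const (p := s) (Or.inl (h₁.pos x).ne')
      have a2 := (h₂.differentiable x).hasFDerivAt.rpow_const (p := s) (Or.inl (h₂.pos x).ne')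
      have a3 := (a1.add a2).rpow_const (p := 1 / s) (Or.inl hwp.ne')
      refine a3.fderiv.trans ?_
      simp only [Pi.add_apply, ← hw]
      rw [smul_add, smul_add, smul_smul, smul_smul, smul_smul, smul_smul]
      congr 2 <;> field_simp
    -- Joint convexity is applied with a = v^(s-1)∇v and α = v^s, for which |a|^s α^(1-s) is exactly
    -- |∇v|^s.
    have hc := norm_add_rpow_mul_rpow_le hs.le (v₁ x ^ (s - 1) • fderiv ℝ v₁ x)
      (v₂ x ^ (s - 1) • fderiv ℝ v₂ x) hp1 hp2
    have e2 : ∀ {c : ℝ} (L : Rn n →L[ℝ] ℝ), 0 < c →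
        ‖c ^ (s - 1) • L‖ ^ s * (c ^ s) ^ (1 - s) = ‖L‖ ^ s := by
      intro c L hc
      rw [norm_smul, Real.norm_of_nonneg (by positivity), Real.mul_rpow (by positivity)
        (norm_nonneg _), ← Real.rpow_mul hc.le, ← Real.rpow_mul hc.le, mul_right_comm,
        ← Real.rpow_add hc]
      ring_nf
      simp
    rw [e2 _ (h₁.pos x), e2 _ (h₂.pos x)] at hc
    refine le_trans (le_of_eq ?_) hc
    rw [e, norm_smul, Real.norm_of_nonneg (by positivity), Real.mul_rpow (by positivity)
      (norm_nonneg _), ← Real.rpow_mul hwp.le, mul_comm]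
    congr 2
    field_simp
  -- The constant terms add exactly; only the gradient terms lose something.
  rw [barrierEnergy, ← Real.rpow_mul (by have := h₁.const_pos; have := h₂.const_pos; positivity),
    one_div_mul_cancel hs0.ne', Real.rpow_one]
  have := integral_mono (h.integrable hs0) ((h₁.integrable hs0).add (h₂.integrable hs0)) hpt
  simp only [Pi.add_apply] at this
  rw [integral_add (h₁.integrable hs0) (h₂.integrable hs0)] at this
  simp only [barrierEnergy]
  linarith

end IsBarrier

/-! ### Trace inequality for barriers -/

/-- The measure `μ` satisfies the trace inequality with constant `C` for `C¹` functions supported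
in the ball of radius `R`. -/
def TraceInequality {n : ℕ} (s R C : ℝ) (μ : Measure (Rn n)) : Prop :=
  ∀ φ : Rn n → ℝ, ContDiff ℝ 1 φ → tsupport φ ⊆ Metric.closedBall 0 R →
    ∫ x, |φ x| ^ s ∂μ ≤ C * ∫ x, ‖fderiv ℝ φ x‖ ^ s

theorem IsBarrier.integrable_rpow {n : ℕ} {R d : ℝ} {v : Rn n → ℝ} (h : IsBarrier R v d)
    {μ : Measure (Rn n)} [IsFiniteMeasure μ] (r : ℝ) : Integrable (fun x => v x ^ r) μ := by
  obtain ⟨m, M, hm, hb⟩ := h.exists_bounds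
  have hc : Continuous fun x => v x ^ r :=
    h.contDiff.continuous.rpow_const fun x => Or.inl (h.pos x).ne'
  refine Integrable.of_bound hc.aestronglyMeasurable (m ^ r + M ^ r) (ae_of_all _ fun x => ?_)
  have hM : 0 < M := hm.trans_le ((hb x).1.trans (hb x).2)
  have h1 := Real.rpow_nonneg hm.le r
  have h2 := Real.rpow_nonneg hM.le r
  rw [Real.norm_of_nonneg (Real.rpow_nonneg (h.pos x).le r)]
  rcases le_total 0 r with hr | hr
  · linarith [Real.rpow_le_rpow (h.pos x).le (hb x).2 hr]
  · linarith [Real.rpow_le_rpow_of_nonpos hm (hb x).1 hr]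

/-- The trace inequality applies to v - d, which is supported in the ball. Putting d back costs d^s
times the total mass, which the term d^s of the energy pays for. -/
theorem TraceInequality.barrier {n : ℕ} {s R C : ℝ} (hs : 1 < s) (hC : 0 ≤ C)
    {μ : Measure (Rn n)} [IsFiniteMeasure μ] (ht : TraceInequality s R C μ) {v : Rn n → ℝ} {d : ℝ}
    (h : IsBarrier R v d) :
    ∫ x, v x ^ s ∂μ ≤ 2 ^ s * (C + μ.real Set.univ) * barrierEnergy s v d := by
  have hs0 : 0 < s := by linarith
  have h1 := ht _ (h.contDiff.sub contDiff_const) h.tsupport_sub_const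
  simp only [fderiv_sub_const] at h1
  have hi : Integrable (fun x => |v x - d| ^ s) μ :=
    integrable_rpow_of_compactSupport hs0 (h.contDiff.continuous.sub continuous_const)
      (isCompact_tsupport_of_subset_closedBall h.tsupport_sub_const)
  have h2 : ∫ x, v x ^ s ∂μ ≤ ∫ x, 2 ^ s * (|v x - d| ^ s + d ^ s) ∂μ := by
    refine integral_mono (h.integrable_rpow s) ((hi.add (integrable_const _)).const_mul _) ?_
    intro x
    refine le_trans ?_ (add_rpow_le_two_rpow_mul hs0.le (abs_nonneg _) h.const_pos.le)
    exact Real.rpow_le_rpow (h.pos x).le (by linarith [le_abs_self (v x - d)]) hs0.le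
  rw [integral_const_mul, integral_add hi (integrable_const _), integral_const, smul_eq_mul] at h2
  refine h2.trans ?_
  rw [mul_assoc]
  gcongr
  have hd := Real.rpow_nonneg h.const_pos.le s
  have hE : 0 ≤ ∫ x, ‖fderiv ℝ v x‖ ^ s := integral_nonneg fun x => by positivity
  have hm : 0 ≤ μ.real Set.univ := measureReal_nonneg
  rw [barrierEnergy]
  nlinarith [mul_nonneg hC hd, mul_nonneg hm hE]

/-! ### Hardy inequality for almost minimal barriers -/

theorem hasFDerivAt_abs_rpow {n : ℕ} {s : ℝ} (hs : 1 < s) {ψ : Rn n → ℝ}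
    (hψ : Differentiable ℝ ψ) (x : Rn n) :
    HasFDerivAt (fun x => |ψ x| ^ s) ((s * |ψ x| ^ (s - 2) * ψ x) • fderiv ℝ ψ x) x :=
  (hasDerivAt_abs_rpow (ψ x) hs).comp_hasFDerivAt x (hψ x).hasFDerivAt

section variation

variable {n : ℕ} {s R d : ℝ} {h ψ : Rn n → ℝ}

/-- The variation used to test the minimality of a barrier `h`. -/
noncomputable def variation (s : ℝ) (h ψ : Rn n → ℝ) (x : Rn n) : ℝ :=
  |ψ x| ^ s * h x ^ (1 - s ^ 2)

theorem contDiff_variation (hs : 1 < s) (hh : IsBarrier R h d) (hψ : ContDiff ℝ 1 ψ) :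
    ContDiff ℝ 1 (variation s h ψ) :=
  (hψ.norm_rpow hs).mul (hh.contDiff.rpow_const_of_ne fun x => (hh.pos x).ne')

theorem tsupport_variation_subset (hs : 1 < s) (hψs : tsupport ψ ⊆ Metric.closedBall 0 R) :
    tsupport (variation s h ψ) ⊆ Metric.closedBall 0 R :=
  tsupport_subset_closedBall fun x hx => by
    rw [variation, eq_zero_of_notMem_closedBall hψs hx, abs_zero, Real.zero_rpow (by linarith),
      zero_mul]

/-- The convexity estimate behind the Hardy inequality with weight `h^(s - s²)`. -/
theorem norm_fderiv_add_variation_le (hs : 1 < s) (hh : IsBarrier R h d) (hψ : ContDiff ℝ 1 ψ)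
    {t : ℝ} (ht : 0 < t) {x : Rn n}
    (hθ : t * (s ^ 2 - 1) * (|ψ x| ^ s * h x ^ (-s ^ 2)) ≤ 1) :
    ‖fderiv ℝ (fun x => h x + t * variation s h ψ x) x‖ ^ s ≤ ‖fderiv ℝ h x‖ ^ s -
      t * (s ^ 2 - 1) * (|ψ x| ^ s * h x ^ (-s ^ 2) * ‖fderiv ℝ h x‖ ^ s) +
      t * (s ^ 2 - 1) * (s / (s ^ 2 - 1)) ^ s * (‖fderiv ℝ ψ x‖ ^ s * h x ^ (s - s ^ 2)) := by
  have hs0 : 0 < s := by linarith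
  have hb : 0 < s ^ 2 - 1 := by nlinarith
  have hp := hh.pos x
  have a1 := hasFDerivAt_abs_rpow hs (hψ.differentiable one_ne_zero) x
  have a2 := (hh.differentiable x).hasFDerivAt.rpow_const (p := 1 - s ^ 2) (Or.inl hp.ne')
  have a3 := (hh.differentiable x).hasFDerivAt.add ((a1.mul a2).const_mul t)
  have e : fderiv ℝ (fun x => h x + t * variation s h ψ x) x = _ := a3.fderiv
  -- The convex combination used below divides by ψ x, so zeros of ψ are treated apart; there the
  -- gradient of the variation vanishes.
  by_cases h0 : ψ x = 0
  · have : fderiv ℝ (fun x => h x + t * variation s h ψ x) x = fderiv ℝ h x := by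
      rw [e, h0]; simp [Real.zero_rpow hs0.ne']
    rw [this, h0, abs_zero, Real.zero_rpow hs0.ne']
    have : 0 ≤ t * (s ^ 2 - 1) * (s / (s ^ 2 - 1)) ^ s *
      (‖fderiv ℝ ψ x‖ ^ s * h x ^ (s - s ^ 2)) := by positivity
    linarith
  · have hψp : 0 < |ψ x| := abs_pos.2 h0
    set θ := t * (s ^ 2 - 1) * (|ψ x| ^ s * h x ^ (-s ^ 2)) with hθdef
    -- The exponents of the variation make the perturbed gradient a convex combination, of weight θ,
    -- of ∇h and a multiple of ∇ψ. In θ times the s-th power of the latter all powers of ψ cancel.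
    have e2 : fderiv ℝ (fun x => h x + t * variation s h ψ x) x =
        (1 - θ) • fderiv ℝ h x + θ • ((s * h x / ((s ^ 2 - 1) * ψ x)) • fderiv ℝ ψ x) := by
      have hA : t * |ψ x| ^ s * ((1 - s ^ 2) * h x ^ (1 - s ^ 2 - 1)) = -θ := by
        rw [hθdef, show 1 - s ^ 2 - 1 = -s ^ 2 by ring]; ring
      have hB : t * h x ^ (1 - s ^ 2) * (s * |ψ x| ^ (s - 2) * ψ x) =
          θ * (s * h x / ((s ^ 2 - 1) * ψ x)) := by
        rw [hθdef, sub_eq_add_neg 1, Real.rpow_add hp, Real.rpow_one, Real.rpow_sub hψp,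
          Real.rpow_two, sq_abs]
        field_simp
      rw [e]
      ext y
      simp only [_root_.add_apply, _root_.smul_apply, smul_eq_mul]
      linear_combination (fderiv ℝ h x y) * hA + (fderiv ℝ ψ x y) * hB
    have hc := norm_convex_comb_rpow_le hs.le (by positivity) hθ (fderiv ℝ h x)
      ((s * h x / ((s ^ 2 - 1) * ψ x)) • fderiv ℝ ψ x)
    rw [e2]
    refine hc.trans (le_of_eq ?_)
    have e3 : θ * ‖(s * h x / ((s ^ 2 - 1) * ψ x)) • fderiv ℝ ψ x‖ ^ s =
        t * (s ^ 2 - 1) * (s / (s ^ 2 - 1)) ^ s * (‖fderiv ℝ ψ x‖ ^ s * h x ^ (s - s ^ 2)) := by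
      rw [norm_smul, Real.mul_rpow (by positivity) (norm_nonneg _), Real.norm_eq_abs, abs_div,
        abs_mul, abs_mul, abs_of_pos hs0, abs_of_pos hp, abs_of_pos hb,
        Real.div_rpow (by positivity) (by positivity), Real.mul_rpow hs0.le hp.le,
        Real.mul_rpow hb.le hψp.le, Real.div_rpow hs0.le hb.le, hθdef, sub_eq_add_neg s,
        Real.rpow_add hp]
      have h1 := (Real.rpow_pos_of_pos hψp s).ne'
      have h2 := (Real.rpow_pos_of_pos hb s).ne'
      field_simp
    rw [e3, hθdef]
    ring

end variation

section hardy

variable {n : ℕ} {s R d : ℝ} {h ψ : Rn n → ℝ}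

theorem integrable_mul_barrier_rpow (hs : 0 < s) (hh : IsBarrier R h d) {F : Type*}
    [NormedAddCommGroup F] {f : Rn n → F} (hf : Continuous f)
    (hfs : tsupport f ⊆ Metric.closedBall 0 R) {μ : Measure (Rn n)} [IsFiniteMeasureOnCompacts μ]
    (r : ℝ) : Integrable (fun x => ‖f x‖ ^ s * h x ^ r) μ := by
  refine Continuous.integrable_of_hasCompactSupport ?_ ?_
  · exact (hf.norm.rpow_const fun _ => Or.inr hs.le).mul
      (hh.contDiff.continuous.rpow_const fun x => Or.inl (hh.pos x).ne')
  · exact isCompact_tsupport_of_subset_closedBall (tsupport_subset_closedBall fun x hx => by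
      rw [eq_zero_of_notMem_closedBall hfs hx, norm_zero, Real.zero_rpow hs.ne', zero_mul])

theorem tsupport_fderiv_subset_closedBall (hψs : tsupport ψ ⊆ Metric.closedBall 0 R) :
    tsupport (fderiv ℝ ψ) ⊆ Metric.closedBall 0 R :=
  (tsupport_fderiv_subset ℝ).trans hψs

theorem integrable_hardy (hs : 1 < s) (hh : IsBarrier R h d) (hψ : ContDiff ℝ 1 ψ)
    (hψs : tsupport ψ ⊆ Metric.closedBall 0 R) :
    Integrable (fun x => |ψ x| ^ s * h x ^ (-s ^ 2) * ‖fderiv ℝ h x‖ ^ s) volume := by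
  have hs0 : 0 < s := by linarith
  refine Continuous.integrable_of_hasCompactSupport ?_ ?_
  · exact ((hψ.continuous.abs.rpow_const fun _ => Or.inr hs0.le).mul
      (hh.contDiff.continuous.rpow_const fun x => Or.inl (hh.pos x).ne')).mul
      (hh.continuous_fderiv.norm.rpow_const fun _ => Or.inr hs0.le)
  · exact isCompact_tsupport_of_subset_closedBall (tsupport_subset_closedBall fun x hx => by
      rw [eq_zero_of_notMem_closedBall hψs hx, abs_zero, Real.zero_rpow hs0.ne', zero_mul,
        zero_mul])

/-- A Hardy inequality for an almost minimal barrier, with an error term. -/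
theorem hardy_of_almost_minimal (hs : 1 < s) (hh : IsBarrier R h d) (hψ : ContDiff ℝ 1 ψ)
    (hψs : tsupport ψ ⊆ Metric.closedBall 0 R) {t ε : ℝ} (ht : 0 < t)
    (hθ : ∀ x, t * (s ^ 2 - 1) * (|ψ x| ^ s * h x ^ (-s ^ 2)) ≤ 1)
    (hmin : barrierEnergy s h d ≤ barrierEnergy s (fun x => h x + t * variation s h ψ x) d + ε) :
    ∫ x, |ψ x| ^ s * h x ^ (-s ^ 2) * ‖fderiv ℝ h x‖ ^ s ≤
      (s / (s ^ 2 - 1)) ^ s * (∫ x, ‖fderiv ℝ ψ x‖ ^ s * h x ^ (s - s ^ 2)) +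
        ε / (t * (s ^ 2 - 1)) := by
  have hs0 : 0 < s := by linarith
  have hb : 0 < s ^ 2 - 1 := by nlinarith
  have hη : ContDiff ℝ 1 fun x => t * variation s h ψ x :=
    contDiff_const.mul (contDiff_variation hs hh hψ)
  have hηs : tsupport (fun x => t * variation s h ψ x) ⊆ Metric.closedBall 0 R :=
    tsupport_subset_closedBall fun x hx => by
      rw [eq_zero_of_notMem_closedBall (tsupport_variation_subset hs hψs) hx, mul_zero]
  have hη0 : ∀ x, 0 ≤ t * variation s h ψ x := fun x =>
    mul_nonneg ht.le (mul_nonneg (by positivity) (Real.rpow_nonneg (hh.pos x).le _))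
  have hcomp := hh.add_of_nonneg hη hη0 hηs
  have i1 := hh.integrable hs0
  have i2 := integrable_hardy hs hh hψ hψs
  have i3 : Integrable (fun x => ‖fderiv ℝ ψ x‖ ^ s * h x ^ (s - s ^ 2)) volume :=
    integrable_mul_barrier_rpow hs0 hh (hψ.continuous_fderiv one_ne_zero)
      (tsupport_fderiv_subset_closedBall hψs) _
  have hle := integral_mono (hcomp.integrable hs0)
    ((i1.sub (i2.const_mul (t * (s ^ 2 - 1)))).add
      (i3.const_mul (t * (s ^ 2 - 1) * (s / (s ^ 2 - 1)) ^ s)))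
    fun x => norm_fderiv_add_variation_le hs hh hψ ht (hθ x)
  have i12 : Integrable (fun x => ‖fderiv ℝ h x‖ ^ s - t * (s ^ 2 - 1) *
      (|ψ x| ^ s * h x ^ (-s ^ 2) * ‖fderiv ℝ h x‖ ^ s)) volume := i1.sub (i2.const_mul _)
  simp only [Pi.add_apply, Pi.sub_apply] at hle
  rw [integral_add i12 (i3.const_mul _), integral_sub i1 (i2.const_mul _),
    integral_const_mul, integral_const_mul] at hle
  simp only [barrierEnergy] at hmin
  have htb : 0 < t * (s ^ 2 - 1) := by positivity
  rw [← sub_le_iff_le_add', le_div_iff₀ htb]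
  linarith

end hardy

/-! ### The dual estimate -/

/-- The dual estimate: `∫ |ψ| dμ` is controlled by the weighted norm of the gradient of `ψ`, for
every barrier `v`. -/
theorem TraceInequality.exists_dual_estimate {n : ℕ} {s R C : ℝ} (hs : 1 < s) (hC : 0 ≤ C)
    {μ : Measure (Rn n)} [IsFiniteMeasure μ] (ht : TraceInequality s R C μ) :
    ∃ K : ℝ, 0 ≤ K ∧ ∀ (ψ v : Rn n → ℝ) (d : ℝ), ContDiff ℝ 1 ψ →
      tsupport ψ ⊆ Metric.closedBall 0 R → IsBarrier R v d →
      ∫ x, |ψ x| ∂μ ≤ K *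
        ((∫ x, ‖fderiv ℝ ψ x‖ ^ s * v x ^ (s - s ^ 2)) + barrierEnergy s v d) := by
  have hs0 : 0 < s := by linarith
  have hb : 0 < s ^ 2 - 1 := by nlinarith
  set K₁ := C * 2 ^ s * (1 + (s - 1) ^ s * (s / (s ^ 2 - 1)) ^ s) with hK₁
  set K₂ := C * 2 ^ s * (s - 1) ^ s with hK₂
  set K₃ := 2 ^ s * (C + μ.real Set.univ) with hK₃
  have hs1 : 0 < s - 1 := by linarith
  have hK₁0 : 0 ≤ K₁ := by positivity
  have hK₂0 : 0 ≤ K₂ := by positivity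
  have hK₃0 : 0 ≤ K₃ := by positivity
  refine ⟨K₁ + K₃, by positivity, fun ψ v d hψ hψs hv => ?_⟩
  have hψc := isCompact_tsupport_of_subset_closedBall hψs
  obtain ⟨B, hB⟩ := hψ.continuous.bounded_above_of_compact_support hψc
  have hB0 : 0 ≤ B := (norm_nonneg _).trans (hB 0)
  obtain ⟨m, M, hm, hmM⟩ := hv.exists_bounds
  -- This t makes the weight θ at most 1 for every barrier h ≥ v, since h ≥ m and |ψ| ≤ B. It does
  -- not depend on ε, so the error ε/(t(s²-1)) vanishes as ε → 0.
  set t := 1 / ((s ^ 2 - 1) * (B ^ s * m ^ (-s ^ 2) + 1)) with ht_def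
  have ht0 : 0 < t := by positivity
  set Y := ∫ x, ‖fderiv ℝ ψ x‖ ^ s * v x ^ (s - s ^ 2) with hY
  have hY0 : 0 ≤ Y := integral_nonneg fun x =>
    mul_nonneg (by positivity) (Real.rpow_nonneg (hv.pos x).le _)
  have main : ∀ ε : ℝ, 0 < ε → ∫ x, |ψ x| ∂μ ≤
      K₁ * Y + K₃ * barrierEnergy s v d + (K₂ / (t * (s ^ 2 - 1)) + K₃) * ε := by
    intro ε hε
    -- An obstacle problem: energies of the barriers lying above v. Near-minimizers suffice, so no
    -- existence or regularity of a minimizer is needed.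
    let S : Set ℝ := {E | ∃ (h : Rn n → ℝ) (e : ℝ), IsBarrier R h e ∧ (∀ x, v x ≤ h x) ∧
      barrierEnergy s h e = E}
    have hSne : S.Nonempty := ⟨_, v, d, hv, fun _ => le_rfl, rfl⟩
    have hSbdd : BddBelow S := ⟨0, by rintro _ ⟨h, e, hh, _, rfl⟩; exact hh.energy_pos.le⟩
    obtain ⟨_, ⟨h, e, hh, hvh, rfl⟩, hlt⟩ := Real.lt_sInf_add_pos hSne hε
    have hEv : barrierEnergy s h e ≤ barrierEnergy s v d + ε := by
      have : sInf S ≤ barrierEnergy s v d := csInf_le hSbdd ⟨v, d, hv, fun _ => le_rfl, rfl⟩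
      linarith
    have hη : ContDiff ℝ 1 fun x => t * variation s h ψ x :=
      contDiff_const.mul (contDiff_variation hs hh hψ)
    have hηs : tsupport (fun x => t * variation s h ψ x) ⊆ Metric.closedBall 0 R :=
      tsupport_subset_closedBall fun x hx => by
        rw [eq_zero_of_notMem_closedBall (tsupport_variation_subset hs hψs) hx, mul_zero]
    have hη0 : ∀ x, 0 ≤ t * variation s h ψ x := fun x =>
      mul_nonneg ht0.le (mul_nonneg (by positivity) (Real.rpow_nonneg (hh.pos x).le _))
    -- The variation is nonnegative, so the competitor stays above the obstacle v.
    have hmin : barrierEnergy s h e ≤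
        barrierEnergy s (fun x => h x + t * variation s h ψ x) e + ε := by
      have : sInf S ≤ barrierEnergy s (fun x => h x + t * variation s h ψ x) e :=
        csInf_le hSbdd ⟨_, e, hh.add_of_nonneg hη hη0 hηs,
          fun x => (hvh x).trans (le_add_of_nonneg_right (hη0 x)), rfl⟩
      linarith
    have hθ : ∀ x, t * (s ^ 2 - 1) * (|ψ x| ^ s * h x ^ (-s ^ 2)) ≤ 1 := by
      intro x
      have h1 : |ψ x| ^ s ≤ B ^ s := Real.rpow_le_rpow (abs_nonneg _) (hB x) hs0.le
      have h2 : h x ^ (-s ^ 2) ≤ m ^ (-s ^ 2) :=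
        Real.rpow_le_rpow_of_nonpos hm ((hmM x).1.trans (hvh x)) (by nlinarith)
      have h3 : |ψ x| ^ s * h x ^ (-s ^ 2) ≤ B ^ s * m ^ (-s ^ 2) :=
        mul_le_mul h1 h2 (Real.rpow_nonneg (hh.pos x).le _) (by positivity)
      have h4 : t * (s ^ 2 - 1) = 1 / (B ^ s * m ^ (-s ^ 2) + 1) := by
        rw [ht_def]; field_simp
      rw [h4, one_div_mul_eq_div, div_le_one (by positivity)]
      linarith
    have hZ := hardy_of_almost_minimal hs hh hψ hψs ht0 hθ hmin
    set Z := ∫ x, |ψ x| ^ s * h x ^ (-s ^ 2) * ‖fderiv ℝ h x‖ ^ s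
    have i2 := integrable_hardy hs hh hψ hψs
    have hDψs := tsupport_fderiv_subset_closedBall hψs
    have hDψc := hψ.continuous_fderiv one_ne_zero
    have i3 : Integrable (fun x => ‖fderiv ℝ ψ x‖ ^ s * h x ^ (s - s ^ 2)) volume :=
      integrable_mul_barrier_rpow hs0 hh hDψc hDψs _
    have i4 : Integrable (fun x => ‖fderiv ℝ ψ x‖ ^ s * v x ^ (s - s ^ 2)) volume :=
      integrable_mul_barrier_rpow hs0 hv hDψc hDψs _
    -- The exponent s - s² is negative and h ≥ v, so replacing v by h only decreases the weighted
    -- energy.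
    have hYh : ∫ x, ‖fderiv ℝ ψ x‖ ^ s * h x ^ (s - s ^ 2) ≤ Y :=
      integral_mono i3 i4 fun x => mul_le_mul_of_nonneg_left
        (Real.rpow_le_rpow_of_nonpos (hv.pos x) (hvh x) (by nlinarith)) (by positivity)
    set Yh := ∫ x, ‖fderiv ℝ ψ x‖ ^ s * h x ^ (s - s ^ 2)
    -- With this power of h, |∇φ|^s is bounded by the two integrands of the Hardy inequality. This
    -- dictates the exponent 1 - s² in the variation.
    let φ : Rn n → ℝ := fun x => ψ x * h x ^ (1 - s)
    have hφ : ContDiff ℝ 1 φ := hψ.mul (hh.contDiff.rpow_const_of_ne fun x => (hh.pos x).ne')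
    have hφs : tsupport φ ⊆ Metric.closedBall 0 R := tsupport_subset_closedBall fun x hx => by
      simp only [φ, eq_zero_of_notMem_closedBall hψs hx, zero_mul]
    have hφc := isCompact_tsupport_of_subset_closedBall hφs
    have hDφ : ∀ x, ‖fderiv ℝ φ x‖ ^ s ≤ 2 ^ s * (‖fderiv ℝ ψ x‖ ^ s * h x ^ (s - s ^ 2) +
        (s - 1) ^ s * (|ψ x| ^ s * h x ^ (-s ^ 2) * ‖fderiv ℝ h x‖ ^ s)) := by
      intro x
      have hp := hh.pos x
      have a1 := (hψ.differentiable one_ne_zero x).hasFDerivAt.mul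
        ((hh.differentiable x).hasFDerivAt.rpow_const (p := 1 - s) (Or.inl hp.ne'))
      have hn : ‖fderiv ℝ φ x‖ ≤ (s - 1) * (|ψ x| * h x ^ (-s) * ‖fderiv ℝ h x‖) +
          ‖fderiv ℝ ψ x‖ * h x ^ (1 - s) := by
        rw [show fderiv ℝ φ x = _ from a1.fderiv]
        refine (norm_add_le _ _).trans (add_le_add (le_of_eq ?_) (le_of_eq ?_))
        · rw [norm_smul, norm_smul, norm_mul, Real.norm_eq_abs, Real.norm_eq_abs,
            Real.norm_of_nonneg (Real.rpow_nonneg hp.le _), abs_of_neg (by linarith : 1 - s < 0),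
            show 1 - s - 1 = -s by ring]
          ring
        · rw [norm_smul, Real.norm_of_nonneg (Real.rpow_nonneg hp.le _), mul_comm]
      refine (Real.rpow_le_rpow (norm_nonneg _) hn hs0.le).trans
        ((add_rpow_le_two_rpow_mul hs0.le (by positivity) (by positivity)).trans (le_of_eq ?_))
      rw [Real.mul_rpow hs1.le (by positivity), Real.mul_rpow (by positivity) (by positivity),
        Real.mul_rpow (by positivity) (by positivity), Real.mul_rpow (by positivity)
        (by positivity), ← Real.rpow_mul hp.le, ← Real.rpow_mul hp.le,
        show -s * s = -s ^ 2 by ring, show (1 - s) * s = s - s ^ 2 by ring]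
      ring
    have htr := ht φ hφ hφs
    have hint : ∫ x, ‖fderiv ℝ φ x‖ ^ s ≤ 2 ^ s * (Yh + (s - 1) ^ s * Z) := by
      have := integral_mono (integrable_rpow_of_compactSupport hs0
        (hφ.continuous_fderiv one_ne_zero) (hφc.fderiv ℝ))
        ((i3.add (i2.const_mul ((s - 1) ^ s))).const_mul (2 ^ s)) hDφ
      simp only [Pi.add_apply] at this
      rwa [integral_const_mul, integral_add i3 (i2.const_mul _), integral_const_mul] at this
    have hbar := ht.barrier hs hC hh
    -- Since |ψ| = |φ| h^(s-1), Young's inequality with exponents s and s/(s-1) applies.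
    have hyoung : ∀ x, |ψ x| ≤ |φ x| ^ s + h x ^ s := by
      intro x
      have hp := hh.pos x
      have hconj : s.HolderConjugate (s / (s - 1)) := Real.HolderConjugate.conjExponent hs
      have h1 := Real.young_inequality_of_nonneg (abs_nonneg (φ x))
        (Real.rpow_nonneg hp.le (s - 1)) hconj
      rw [← Real.rpow_mul hp.le, mul_div_cancel₀ _ hs1.ne', abs_mul,
        abs_of_pos (Real.rpow_pos_of_pos hp _), mul_assoc, ← Real.rpow_add hp] at h1
      simp only [sub_add_sub_cancel, sub_self, Real.rpow_zero, mul_one] at h1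
      refine h1.trans (add_le_add ?_ ?_)
      · rw [abs_mul, abs_of_pos (Real.rpow_pos_of_pos hp _)]
        exact div_le_self (by positivity) hs.le
      · refine div_le_self (by positivity) ?_
        rw [le_div_iff₀ hs1]; linarith
    have i5 : Integrable (fun x => |φ x| ^ s) μ :=
      integrable_rpow_of_compactSupport hs0 hφ.continuous hφc
    have hsum : ∫ x, |ψ x| ∂μ ≤ (∫ x, |φ x| ^ s ∂μ) + ∫ x, h x ^ s ∂μ := by
      rw [← integral_add i5 (hh.integrable_rpow s)]
      exact integral_mono (hψ.continuous.integrable_of_hasCompactSupport hψc).abs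
        (i5.add (hh.integrable_rpow s)) hyoung
    calc ∫ x, |ψ x| ∂μ ≤ C * (2 ^ s * (Yh + (s - 1) ^ s * Z)) + K₃ * barrierEnergy s h e := by
          refine hsum.trans (add_le_add (htr.trans ?_) hbar)
          gcongr
      _ ≤ C * (2 ^ s * (Y + (s - 1) ^ s * ((s / (s ^ 2 - 1)) ^ s * Y + ε / (t * (s ^ 2 - 1))))) +
          K₃ * (barrierEnergy s v d + ε) := by
          have : Z ≤ (s / (s ^ 2 - 1)) ^ s * Y + ε / (t * (s ^ 2 - 1)) :=
            hZ.trans (by gcongr)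
          gcongr
      _ = _ := by rw [hK₁, hK₂]; ring
  have hE := hv.energy_pos (s := s)
  have h0 : ∫ x, |ψ x| ∂μ ≤ K₁ * Y + K₃ * barrierEnergy s v d := by
    refine le_of_forall_pos_le_add fun δ hδ => ?_
    set L := K₂ / (t * (s ^ 2 - 1)) + K₃
    have hL : 0 ≤ L := by positivity
    refine (main (δ / (L + 1)) (by positivity)).trans ?_
    gcongr
    rw [mul_div_assoc', div_le_iff₀ (by positivity)]
    nlinarith
  refine h0.trans ?_
  nlinarith [mul_nonneg hK₁0 hE.le, mul_nonneg hK₃0 hY0]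

/-! ### Functionals on bounded fields and their densities -/

/-- The space of bounded measurable vector fields on `ℝⁿ`. -/
def boundedFields (n : ℕ) : Submodule ℝ (Rn n → Rn n) where
  carrier := {G | Measurable G ∧ ∃ B : ℝ, ∀ x, ‖G x‖ ≤ B}
  zero_mem' := ⟨measurable_const, 0, fun x => by simp⟩
  add_mem' := by
    rintro G H ⟨hG, B, hB⟩ ⟨hH, B', hB'⟩
    exact ⟨hG.add hH, B + B', fun x => (norm_add_le _ _).trans (add_le_add (hB x) (hB' x))⟩
  smul_mem' := by
    rintro c G ⟨hG, B, hB⟩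
    refine ⟨hG.const_smul c, |c| * B, fun x => ?_⟩
    rw [Pi.smul_apply, norm_smul, Real.norm_eq_abs]
    exact mul_le_mul_of_nonneg_left (hB x) (abs_nonneg c)

theorem indicator_mem_boundedFields {n : ℕ} {S : Set (Rn n)} (hS : MeasurableSet S) (c : Rn n) :
    (S.indicator fun _ => c) ∈ boundedFields n :=
  ⟨measurable_const.indicator hS, ‖c‖, fun x => by
    by_cases hx : x ∈ S <;> simp [hx]⟩

/-- The bounded field equal to `c` on `S` and to `0` elsewhere. -/
noncomputable def indicatorField {n : ℕ} {S : Set (Rn n)} (hS : MeasurableSet S) (c : Rn n) :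
    boundedFields n :=
  ⟨S.indicator fun _ => c, indicator_mem_boundedFields hS c⟩

theorem simpleFunc_mem_boundedFields {n : ℕ} (f : SimpleFunc (Rn n) (Rn n)) :
    ⇑f ∈ boundedFields n :=
  ⟨f.measurable, f.exists_forall_norm_le⟩

section representation

variable {n : ℕ} {s : ℝ} {ν : Measure (Rn n)}

theorem integral_norm_indicatorField (hs : 0 < s) {S : Set (Rn n)} (hS : MeasurableSet S)
    {c : Rn n} (hc : ‖c‖ = 1) :
    ∫ x, ‖(indicatorField hS c : Rn n → Rn n) x‖ ^ s ∂ν = ν.real S := by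
  have : (fun x => ‖(indicatorField hS c : Rn n → Rn n) x‖ ^ s) = S.indicator fun _ => (1 : ℝ) := by
    ext x
    by_cases hx : x ∈ S <;> simp [indicatorField, hx, hc, Real.zero_rpow hs.ne']
  rw [this, integral_indicator_const _ hS, smul_eq_mul, mul_one]

variable [IsFiniteMeasure ν]

/-- Countable additivity from continuity: the field on the part D not covered by finitely many sets
has L^s seminorm controlled by ν(D), which is small. -/
theorem hasSum_indicatorField (hs : 0 < s) (L : boundedFields n →ₗ[ℝ] ℝ)
    (hL : ∀ ε : ℝ, 0 < ε → ∃ δ : ℝ, 0 < δ ∧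
      ∀ G : boundedFields n, ∫ x, ‖(G : Rn n → Rn n) x‖ ^ s ∂ν ≤ δ → |L G| ≤ ε)
    {c : Rn n} (hc : ‖c‖ = 1) {f : ℕ → Set (Rn n)} (hf : ∀ k, MeasurableSet (f k))
    (hd : Pairwise (Function.onFun Disjoint f)) :
    HasSum (fun k => L (indicatorField (hf k) c))
      (L (indicatorField (MeasurableSet.iUnion hf) c)) := by
  have hsum : HasSum (fun k => ν.real (f k)) (ν.real (⋃ k, f k)) := by
    have := hasSum_integral_iUnion (μ := ν) (f := fun _ => (1 : ℝ)) hf hd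
      (integrable_const _).integrableOn
    simpa using this
  refine Metric.tendsto_nhds.2 fun ε hε => ?_
  obtain ⟨δ, hδ, hLδ⟩ := hL (ε / 2) (by positivity)
  filter_upwards [Metric.tendsto_nhds.1 hsum δ hδ] with T hT
  have hTm : MeasurableSet (⋃ k ∈ T, f k) := T.measurableSet_biUnion fun k _ => hf k
  set D := (⋃ k, f k) \ ⋃ k ∈ T, f k with hD
  have hDm : MeasurableSet D := (MeasurableSet.iUnion hf).diff hTm
  have hsub : (⋃ k ∈ T, f k) ⊆ ⋃ k, f k := Set.iUnion₂_subset fun k _ => Set.subset_iUnion f k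
  have hdisj : (T : Set ℕ).PairwiseDisjoint f := fun a _ b _ hab => hd hab
  have hDν : ν.real D ≤ δ := by
    rw [hD, measureReal_sdiff hsub hTm, measureReal_biUnion_finset hdisj fun k _ => hf k]
    rw [Real.dist_eq, abs_sub_comm] at hT
    exact (le_abs_self _).trans hT.le
  have hdecomp : indicatorField (MeasurableSet.iUnion hf) c =
      indicatorField hDm c + ∑ k ∈ T, indicatorField (hf k) c := by
    apply Subtype.ext
    simp only [indicatorField, Submodule.coe_add, AddSubmonoidClass.coe_finsetSum]
    have h1 : (∑ k ∈ T, (f k).indicator fun _ : Rn n => c) =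
        (⋃ k ∈ T, f k).indicator fun _ => c := by
      ext1 x
      rw [Finset.indicator_biUnion_apply T f hdisj, Finset.sum_apply]
    rw [h1, hD]
    refine Eq.trans ?_ (Set.indicator_union_of_disjoint Set.disjoint_sdiff_left _)
    rw [Set.sdiff_union_of_subset hsub]
  rw [hdecomp, map_add, map_sum, dist_comm, dist_eq_norm, add_sub_cancel_right]
  have := hLδ (indicatorField hDm c) (by rwa [integral_norm_indicatorField hs hDm hc])
  rw [Real.norm_eq_abs]
  linarith

open Classical in
/-- The signed measure `S ↦ L (χ_S c)`. -/
noncomputable def fieldMeasure (hs : 0 < s) (L : boundedFields n →ₗ[ℝ] ℝ)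
    (hL : ∀ ε : ℝ, 0 < ε → ∃ δ : ℝ, 0 < δ ∧
      ∀ G : boundedFields n, ∫ x, ‖(G : Rn n → Rn n) x‖ ^ s ∂ν ≤ δ → |L G| ≤ ε)
    {c : Rn n} (hc : ‖c‖ = 1) : SignedMeasure (Rn n) where
  measureOf' S := if hS : MeasurableSet S then L (indicatorField hS c) else 0
  empty' := by
    have : indicatorField (MeasurableSet.empty (α := Rn n)) c = 0 := by
      apply Subtype.ext; ext1 x; simp [indicatorField]
    simp [this]
  not_measurable' S hS := by simp [hS]
  m_iUnion' f hf hd := by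
    simp only [hf, MeasurableSet.iUnion hf, dif_pos]
    exact hasSum_indicatorField hs L hL hc hf hd

/-- Bounded fields are limits of simple fields, boundedly and pointwise. -/
theorem exists_simpleFunc_approx (G : boundedFields n) :
    ∃ (f : ℕ → SimpleFunc (Rn n) (Rn n)) (B : ℝ),
      (∀ x, Tendsto (fun k => f k x) atTop (𝓝 ((G : Rn n → Rn n) x))) ∧
      (∀ k x, ‖f k x‖ ≤ B) ∧ ∀ x, ‖(G : Rn n → Rn n) x‖ ≤ B := by
  obtain ⟨G, hG, B, hB⟩ := G
  refine ⟨fun k => SimpleFunc.approxOn G hG Set.univ 0 (Set.mem_univ _) k, 2 * B,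
    fun x => SimpleFunc.tendsto_approxOn hG (Set.mem_univ _) (by simp), fun k x => ?_, fun x => ?_⟩
  · have := SimpleFunc.norm_approxOn_zero_le hG (Set.mem_univ _) x k
    linarith [hB x]
  · have := (norm_nonneg _).trans (hB x)
    exact (hB x).trans (by linarith)

/-- Dominated convergence in the L^s seminorm of the finite measure ν. It carries the integral
representation from simple fields to all bounded fields. -/
theorem tendsto_of_bounded_of_pointwise (hs : 0 < s) (L : boundedFields n →ₗ[ℝ] ℝ)
    (hL : ∀ ε : ℝ, 0 < ε → ∃ δ : ℝ, 0 < δ ∧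
      ∀ G : boundedFields n, ∫ x, ‖(G : Rn n → Rn n) x‖ ^ s ∂ν ≤ δ → |L G| ≤ ε)
    {f : ℕ → boundedFields n} {G : boundedFields n} {B : ℝ}
    (hfG : ∀ x, Tendsto (fun k => (f k : Rn n → Rn n) x) atTop (𝓝 ((G : Rn n → Rn n) x)))
    (hfB : ∀ k x, ‖(f k : Rn n → Rn n) x‖ ≤ B) (hB : ∀ x, ‖(G : Rn n → Rn n) x‖ ≤ B) :
    Tendsto (fun k => L (f k)) atTop (𝓝 (L G)) := by
  have hlim2 : Tendsto (fun k => ∫ x, ‖((G - f k : boundedFields n) : Rn n → Rn n) x‖ ^ s ∂ν)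
      atTop (𝓝 0) := by
    have h0 : ∫ _ : Rn n, (0 : ℝ) ∂ν = 0 := by simp
    rw [← h0]
    refine tendsto_integral_of_dominated_convergence (fun x => (B + B) ^ s)
      (fun k => ((G - f k).2.1.norm.pow_const s).aestronglyMeasurable)
      (integrable_const _) (fun k => ae_of_all _ fun x => ?_) (ae_of_all _ fun x => ?_)
    · rw [Real.norm_of_nonneg (by positivity)]
      exact Real.rpow_le_rpow (norm_nonneg _)
        ((norm_sub_le _ _).trans (add_le_add (hB x) (hfB k x))) hs.le
    · have h1 : Tendsto (fun k => ‖(G : Rn n → Rn n) x - (f k : Rn n → Rn n) x‖) atTop (𝓝 0) := by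
        have := (tendsto_const_nhds (x := (G : Rn n → Rn n) x)).sub (hfG x)
        rw [sub_self] at this
        simpa using this.norm
      have h2 := h1.rpow_const (p := s) (Or.inr hs.le)
      rwa [Real.zero_rpow hs.ne'] at h2
  refine Metric.tendsto_nhds.2 fun ε hε => ?_
  obtain ⟨δ, hδ, h⟩ := hL (ε / 2) (by positivity)
  filter_upwards [Metric.tendsto_nhds.1 hlim2 δ hδ] with k hk
  rw [dist_comm, Real.dist_eq, ← map_sub]
  rw [Real.dist_eq, sub_zero] at hk
  have := h (G - f k) ((le_abs_self _).trans hk.le)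
  linarith

/-- A functional on bounded fields that is continuous for the `L^s` seminorm has a density. -/
theorem exists_density (hs : 0 < s) (L : boundedFields n →ₗ[ℝ] ℝ)
    (hL : ∀ ε : ℝ, 0 < ε → ∃ δ : ℝ, 0 < δ ∧
      ∀ G : boundedFields n, ∫ x, ‖(G : Rn n → Rn n) x‖ ^ s ∂ν ≤ δ → |L G| ≤ ε) :
    ∃ F : Rn n → Rn n, Measurable F ∧ Integrable F ν ∧
      ∀ G : boundedFields n, L G = ∫ x, inner ℝ (F x) ((G : Rn n → Rn n) x) ∂ν := by
  let e : Fin n → Rn n := fun i => EuclideanSpace.single i 1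
  have he : ∀ i, ‖e i‖ = 1 := fun i => by simp [e]
  let m : Fin n → SignedMeasure (Rn n) := fun i => fieldMeasure hs L hL (he i)
  have hm : ∀ i {S : Set (Rn n)} (hS : MeasurableSet S), m i S = L (indicatorField hS (e i)) :=
    fun i S hS => dif_pos hS
  -- On a ν-null set the seminorm of the indicator field vanishes, so |L| is below every ε;
  -- Radon–Nikodym then applies coordinate by coordinate.
  have hac : ∀ i, VectorMeasure.AbsolutelyContinuous (m i) ν.toENNRealVectorMeasure := by
    refine fun i => VectorMeasure.AbsolutelyContinuous.mk fun S hS h0 => ?_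
    rw [Measure.toENNRealVectorMeasure_apply_measurable hS] at h0
    rw [hm i hS]
    refine abs_nonpos_iff.1 (le_of_forall_pos_le_add fun ε hε => ?_)
    obtain ⟨δ, hδ, h⟩ := hL ε hε
    rw [zero_add]
    refine h _ ?_
    rw [integral_norm_indicatorField hs hS (he i), measureReal_def, h0]
    simpa using hδ.le
  let φ : Fin n → Rn n → ℝ := fun i => (m i).rnDeriv ν
  have hφi : ∀ i, Integrable (φ i) ν := fun i => SignedMeasure.integrable_rnDeriv _ _
  have hφm : ∀ i, Measurable (φ i) := fun i => SignedMeasure.measurable_rnDeriv _ _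
  have hφ : ∀ i {S : Set (Rn n)} (hS : MeasurableSet S),
      L (indicatorField hS (e i)) = ∫ x in S, φ i x ∂ν := by
    intro i S hS
    rw [← hm i hS, ← withDensityᵥ_apply (hφi i) hS,
      SignedMeasure.withDensityᵥ_rnDeriv_eq _ _ (hac i)]
  let F : Rn n → Rn n := fun x => ∑ i, φ i x • e i
  have hFm : Measurable F := Finset.measurable_sum _ fun i _ => (hφm i).smul_const _
  have hFi : Integrable F ν := integrable_finsetSum _ fun i _ => (hφi i).smul_const _
  have hinner : ∀ (x c : Rn n), inner ℝ (F x) c = ∑ i, c i * φ i x := by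
    intro x c
    simp only [F, sum_inner, real_inner_smul_left]
    refine Finset.sum_congr rfl fun i _ => ?_
    simp [e, EuclideanSpace.inner_single_left, mul_comm]
  refine ⟨F, hFm, hFi, ?_⟩
  have hFG : ∀ G : boundedFields n,
      Integrable (fun x => inner ℝ (F x) ((G : Rn n → Rn n) x)) ν := by
    rintro ⟨G, hG, B, hB⟩
    refine (hFi.norm.mul_const B).mono (hFm.inner hG).aestronglyMeasurable (ae_of_all _ fun x => ?_)
    refine (norm_inner_le_norm _ _).trans ?_
    rw [norm_mul, norm_norm]
    gcongr
    exact (hB x).trans (le_abs_self B)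
  have hsimple : ∀ f : SimpleFunc (Rn n) (Rn n),
      L ⟨f, simpleFunc_mem_boundedFields f⟩ = ∫ x, inner ℝ (F x) (f x) ∂ν := by
    intro f
    induction f using SimpleFunc.induction with
    | @const c S hS =>
      have h1 : (⟨_, simpleFunc_mem_boundedFields (SimpleFunc.piecewise S hS
          (SimpleFunc.const _ c) (SimpleFunc.const _ 0))⟩ : boundedFields n) =
          ∑ i, c i • indicatorField hS (e i) := by
        apply Subtype.ext
        ext x j
        by_cases hx : x ∈ S
        · simp [indicatorField, hx, e, Finset.sum_apply, Pi.single_apply]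
        · simp [indicatorField, hx, Finset.sum_apply]
      rw [h1, map_sum]
      have h2 : ∀ x, inner ℝ (F x) ((SimpleFunc.piecewise S hS
          (SimpleFunc.const _ c) (SimpleFunc.const _ 0)) x) =
          S.indicator (fun x => ∑ i, c i * φ i x) x := by
        intro x
        by_cases hx : x ∈ S <;> simp [hx, hinner]
      simp_rw [h2]
      rw [integral_indicator hS, integral_finsetSum _ fun i _ => ((hφi i).const_mul _).integrableOn]
      refine Finset.sum_congr rfl fun i _ => ?_
      rw [map_smul, hφ i hS, integral_const_mul, smul_eq_mul]
    | add hfg h1 h2 =>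
      rename_i f g
      have h3 : (⟨_, simpleFunc_mem_boundedFields (f + g)⟩ : boundedFields n) =
        ⟨f, simpleFunc_mem_boundedFields f⟩ + ⟨g, simpleFunc_mem_boundedFields g⟩ := rfl
      rw [h3, map_add, h1, h2, ← integral_add (hFG ⟨f, simpleFunc_mem_boundedFields f⟩)
        (hFG ⟨g, simpleFunc_mem_boundedFields g⟩)]
      refine integral_congr_ae (ae_of_all _ fun x => ?_)
      simp [inner_add_right]
  intro G
  obtain ⟨f, B, hfG, hfB, hB⟩ := exists_simpleFunc_approx G
  have hlim1 : Tendsto (fun k => ∫ x, inner ℝ (F x) (f k x) ∂ν) atTop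
      (𝓝 (∫ x, inner ℝ (F x) ((G : Rn n → Rn n) x) ∂ν)) := by
    refine tendsto_integral_of_dominated_convergence (fun x => ‖F x‖ * B)
      (fun k => (hFm.inner (f k).measurable).aestronglyMeasurable) (hFi.norm.mul_const _)
      (fun k => ae_of_all _ fun x => ?_) (ae_of_all _ fun x => ?_)
    · exact (norm_inner_le_norm _ _).trans (by gcongr; exact hfB k x)
    · exact tendsto_const_nhds.inner (hfG x)
  have hlim2 := tendsto_of_bounded_of_pointwise hs L hL
    (f := fun k => ⟨f k, simpleFunc_mem_boundedFields (f k)⟩) hfG hfB hB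
  simp_rw [hsimple] at hlim2
  exact tendsto_nhds_unique hlim2 hlim1

end representation

/-! ### The sublinear gauge -/

/-- The weighted energy `∫ |G|^s w^(1-s) dν` of a vector field, for the weight `w = v^s`. -/
noncomputable def weightedEnergy {n : ℕ} (s : ℝ) (ν : Measure (Rn n)) (G : Rn n → Rn n)
    (v : Rn n → ℝ) : ℝ :=
  ∫ x, ‖G x‖ ^ s * v x ^ (s - s ^ 2) ∂ν

/-- The gauge on vector fields obtained by minimizing over all barriers. -/
noncomputable def barrierGauge {n : ℕ} (s R : ℝ) (ν : Measure (Rn n)) (G : Rn n → Rn n) : ℝ :=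
  sInf {c | ∃ (v : Rn n → ℝ) (d : ℝ), IsBarrier R v d ∧
    weightedEnergy s ν G v + barrierEnergy s v d = c}

section gauge

variable {n : ℕ} {s R d : ℝ} {ν : Measure (Rn n)} {G : Rn n → Rn n} {v : Rn n → ℝ}

theorem weightedEnergy_nonneg (hv : IsBarrier R v d) : 0 ≤ weightedEnergy s ν G v :=
  integral_nonneg fun x => mul_nonneg (by positivity) (Real.rpow_nonneg (hv.pos x).le _)

theorem barrierGauge_le (hv : IsBarrier R v d) :
    barrierGauge s R ν G ≤ weightedEnergy s ν G v + barrierEnergy s v d := by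
  refine csInf_le ⟨0, ?_⟩ ⟨v, d, hv, rfl⟩
  rintro _ ⟨v, d, hv, rfl⟩
  exact add_nonneg (weightedEnergy_nonneg hv) hv.energy_pos.le

theorem le_barrierGauge {c : ℝ} (h : ∀ (v : Rn n → ℝ) (d : ℝ), IsBarrier R v d →
    c ≤ weightedEnergy s ν G v + barrierEnergy s v d) : c ≤ barrierGauge s R ν G := by
  refine le_csInf ⟨_, fun _ => 1, 1, IsBarrier.const one_pos, rfl⟩ ?_
  rintro _ ⟨v, d, hv, rfl⟩
  exact h v d hv

theorem weightedEnergy_const : weightedEnergy s ν G (fun _ => d) =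
    (∫ x, ‖G x‖ ^ s ∂ν) * d ^ (s - s ^ 2) :=
  integral_mul_const _ _

theorem integrable_weightedEnergy (hs : 0 < s) [IsFiniteMeasure ν] (hG : G ∈ boundedFields n)
    (hv : IsBarrier R v d) (r : ℝ) : Integrable (fun x => ‖G x‖ ^ s * v x ^ r) ν := by
  obtain ⟨hGm, B, hB⟩ := hG
  refine (hv.integrable_rpow r).bdd_mul (c := B ^ s)
    (hGm.norm.pow_const s).aestronglyMeasurable (ae_of_all _ fun x => ?_)
  rw [Real.norm_of_nonneg (by positivity)]
  exact Real.rpow_le_rpow (norm_nonneg _) (hB x) hs.le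

/-- Replacing v by c^(1/s) v multiplies the energy by c, and the weighted term by c^s · c^(1-s) = c.
The weight exponent s - s² is the one for which both agree. -/
theorem barrierGauge_smul_le (hs : 1 < s) {c : ℝ} (hc : 0 < c) :
    barrierGauge s R ν (c • G) ≤ c * barrierGauge s R ν G := by
  rw [← div_le_iff₀' hc]
  refine le_barrierGauge fun v d hv => ?_
  rw [div_le_iff₀' hc]
  have hs0 : 0 < s := by linarith
  have hr : 0 < c ^ (1 / s) := Real.rpow_pos_of_pos hc _
  refine (barrierGauge_le (hv.const_mul hr)).trans (le_of_eq ?_)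
  rw [hv.energy_const_mul hr, ← Real.rpow_mul hc.le, one_div_mul_cancel hs0.ne', Real.rpow_one,
    mul_add, weightedEnergy, weightedEnergy, ← integral_const_mul]
  congr 1
  refine integral_congr_ae (ae_of_all _ fun x => ?_)
  simp only [Pi.smul_apply]
  rw [norm_smul, Real.norm_of_nonneg hc.le, Real.mul_rpow hc.le (norm_nonneg _),
    Real.mul_rpow hr.le (hv.pos x).le, ← Real.rpow_mul hc.le]
  have : c ^ s * c ^ (1 / s * (s - s ^ 2)) = c := by
    rw [← Real.rpow_add hc]
    have : s + 1 / s * (s - s ^ 2) = 1 := by field_simp; ring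
    rw [this, Real.rpow_one]
  linear_combination (‖G x‖ ^ s * v x ^ (s - s ^ 2)) * this

theorem barrierGauge_smul (hs : 1 < s) {c : ℝ} (hc : 0 < c) :
    barrierGauge s R ν (c • G) = c * barrierGauge s R ν G := by
  refine le_antisymm (barrierGauge_smul_le hs hc) ?_
  have h := barrierGauge_smul_le (R := R) (ν := ν) (G := c • G) hs (inv_pos.2 hc)
  rw [smul_smul, inv_mul_cancel₀ hc.ne', one_smul] at h
  rwa [← le_inv_mul_iff₀ hc]

theorem barrierGauge_zero (hs : 1 < s) : barrierGauge s R ν (0 : Rn n → Rn n) = 0 := by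
  have h := barrierGauge_smul (R := R) (ν := ν) (G := (0 : Rn n → Rn n)) hs two_pos
  rw [smul_zero] at h
  linarith

/-- Two barriers are combined as (v₁^s + v₂^s)^(1/s). Hidden convexity bounds the energy, and the
joint convexity of |a|^s α^(1-s) at α = v^s bounds the weighted term. -/
theorem barrierGauge_add_le (hs : 1 < s) [IsFiniteMeasure ν] {H : Rn n → Rn n}
    (hG : G ∈ boundedFields n) (hH : H ∈ boundedFields n) :
    barrierGauge s R ν (G + H) ≤ barrierGauge s R ν G + barrierGauge s R ν H := by
  have hs0 : 0 < s := by linarith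
  rw [← sub_le_iff_le_add]
  refine le_barrierGauge fun v₁ d₁ h₁ => ?_
  rw [sub_le_iff_le_add, ← sub_le_iff_le_add']
  refine le_barrierGauge fun v₂ d₂ h₂ => ?_
  rw [sub_le_iff_le_add']
  have h := h₁.rpow_add_rpow (s := s) h₂
  refine (barrierGauge_le h).trans ?_
  have hE := h₁.energy_rpow_add_rpow_le hs h₂
  have hW : weightedEnergy s ν (G + H) (fun x => (v₁ x ^ s + v₂ x ^ s) ^ (1 / s)) ≤
      weightedEnergy s ν G v₁ + weightedEnergy s ν H v₂ := by
    have i1 := integrable_weightedEnergy hs0 hG h₁ (s - s ^ 2) (ν := ν)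
    have i2 := integrable_weightedEnergy hs0 hH h₂ (s - s ^ 2) (ν := ν)
    rw [weightedEnergy, weightedEnergy, weightedEnergy, ← integral_add i1 i2]
    refine integral_mono (integrable_weightedEnergy hs0 ((boundedFields n).add_mem hG hH) h _)
      (i1.add i2) fun x => ?_
    have hp1 := Real.rpow_pos_of_pos (h₁.pos x) s
    have hp2 := Real.rpow_pos_of_pos (h₂.pos x) s
    have := norm_add_rpow_mul_rpow_le hs.le (G x) (H x) hp1 hp2
    have e : s * (1 - s) = s - s ^ 2 := by ring
    rw [← Real.rpow_mul (h₁.pos x).le, ← Real.rpow_mul (h₂.pos x).le, e] at this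
    have e2 : 1 / s * (s - s ^ 2) = 1 - s := by field_simp
    simp only [Pi.add_apply]
    rwa [← Real.rpow_mul (by positivity), e2]
  linarith

end gauge

/-! ### Hahn–Banach duality -/

/-- A functional killing the kernel of T descends to the range of T, where the Hahn–Banach extension
starts; a linear right inverse over ℝ provides the factorization. -/
theorem _root_.LinearMap.exists_comp_rangeRestrict_eq {V W : Type*} [AddCommGroup V] [Module ℝ V]
    [AddCommGroup W] [Module ℝ W] (T : V →ₗ[ℝ] W) (l : V →ₗ[ℝ] ℝ)
    (h : ∀ ψ, T ψ = 0 → l ψ = 0) :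
    ∃ g : LinearMap.range T →ₗ[ℝ] ℝ, ∀ ψ, g (T.rangeRestrict ψ) = l ψ := by
  obtain ⟨S, hS⟩ := T.rangeRestrict.exists_rightInverse_of_surjective T.range_rangeRestrict
  refine ⟨l ∘ₗ S, fun ψ => ?_⟩
  have h1 : T.rangeRestrict (S (T.rangeRestrict ψ)) = T.rangeRestrict ψ :=
    LinearMap.congr_fun hS _
  have h2 : T (S (T.rangeRestrict ψ) - ψ) = 0 := by
    rw [map_sub, sub_eq_zero]
    exact congrArg Subtype.val h1
  have := h _ h2
  rwa [map_sub, sub_eq_zero] at this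

section duality

variable {n : ℕ} {s R K : ℝ} {ν : Measure (Rn n)}

/-- A functional dominated by the gauge is continuous for the `L^s` seminorm. -/
theorem continuous_of_le_barrierGauge (hs : 1 < s) (hK : 0 ≤ K) (L : boundedFields n →ₗ[ℝ] ℝ)
    (hL : ∀ G : boundedFields n, L G ≤ K * barrierGauge s R ν G) {ε : ℝ} (hε : 0 < ε) :
    ∃ δ : ℝ, 0 < δ ∧
      ∀ G : boundedFields n, ∫ x, ‖(G : Rn n → Rn n) x‖ ^ s ∂ν ≤ δ → |L G| ≤ ε := by
  have hs0 : 0 < s := by linarith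
  -- The constant barrier d has energy d^s, chosen so that K d^s ≤ ε/2; the threshold δ makes the
  -- weighted term equally small.
  set d := (ε / (2 * (K + 1))) ^ (1 / s) with hd
  have hd0 : 0 < d := by positivity
  have hds : d ^ s = ε / (2 * (K + 1)) := by
    rw [hd, ← Real.rpow_mul (by positivity), one_div_mul_cancel hs0.ne', Real.rpow_one]
  have hdp : 0 < d ^ (s - s ^ 2) := Real.rpow_pos_of_pos hd0 _
  refine ⟨ε / (2 * (K + 1)) / d ^ (s - s ^ 2), by positivity, fun G hG => ?_⟩
  have key : ∀ G : boundedFields n, ∫ x, ‖(G : Rn n → Rn n) x‖ ^ s ∂ν ≤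
      ε / (2 * (K + 1)) / d ^ (s - s ^ 2) → L G ≤ ε := by
    intro G hG
    have h1 := barrierGauge_le (s := s) (ν := ν) (G := G) (IsBarrier.const (R := R) hd0)
    rw [weightedEnergy_const, IsBarrier.energy_const hs0, hds] at h1
    rw [le_div_iff₀ hdp] at hG
    calc L G ≤ K * barrierGauge s R ν G := hL G
      _ ≤ K * (ε / (2 * (K + 1)) + ε / (2 * (K + 1))) := by gcongr; linarith
      _ = K * ε / (K + 1) := by field_simp; ring
      _ ≤ ε := by rw [div_le_iff₀ (by positivity)]; nlinarith
  rw [abs_le']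
  refine ⟨key G hG, ?_⟩
  rw [← map_neg]
  refine key (-G) ?_
  simpa using hG

/-- The duality argument: a functional `l` on a space `V` that is dominated by the gauge of `T ψ`
is represented by a vector field. -/
theorem exists_dual_field [IsFiniteMeasure ν] (hs : 1 < s) (hK : 0 ≤ K)
    {V : Type*} [AddCommGroup V] [Module ℝ V]
    (T : V →ₗ[ℝ] boundedFields n) (l : V →ₗ[ℝ] ℝ)
    (h : ∀ (ψ : V) (v : Rn n → ℝ) (d : ℝ), IsBarrier R v d →
      l ψ ≤ K * (weightedEnergy s ν (T ψ) v + barrierEnergy s v d)) :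
    ∃ F : Rn n → Rn n, Measurable F ∧ Integrable F ν ∧
      (∀ ψ, l ψ = ∫ x, inner ℝ (F x) ((T ψ : Rn n → Rn n) x) ∂ν) ∧
      ∀ G ∈ boundedFields n, ∀ (v : Rn n → ℝ) (d : ℝ), IsBarrier R v d →
        ∫ x, inner ℝ (F x) (G x) ∂ν ≤ K * (weightedEnergy s ν G v + barrierEnergy s v d) := by
  have hs0 : 0 < s := by linarith
  have hl : ∀ ψ, l ψ ≤ K * barrierGauge s R ν (T ψ) := by
    intro ψ
    rcases hK.eq_or_lt with rfl | hK0
    · simpa using h ψ (fun _ => 1) 1 (IsBarrier.const one_pos)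
    · rw [← div_le_iff₀' hK0]
      refine le_barrierGauge fun v d hv => ?_
      rw [div_le_iff₀' hK0]
      exact h ψ v d hv
  have hker : ∀ ψ, T ψ = 0 → l ψ = 0 := by
    intro ψ hψ
    refine le_antisymm ?_ ?_
    · simpa [hψ, barrierGauge_zero hs] using hl ψ
    · simpa [hψ, barrierGauge_zero hs] using hl (-ψ)
  obtain ⟨g, hg⟩ := T.exists_comp_rangeRestrict_eq l hker
  -- Hahn–Banach with the sublinear majorant K times the gauge.
  obtain ⟨L, hL1, hL2⟩ := exists_extension_of_le_sublinear ⟨LinearMap.range T, g⟩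
    (fun G : boundedFields n => K * barrierGauge s R ν G)
    (fun c hc G => by
      rw [Submodule.coe_smul, barrierGauge_smul hs hc]; ring)
    (fun G H => by
      rw [← mul_add]
      exact mul_le_mul_of_nonneg_left (barrierGauge_add_le hs G.2 H.2) hK)
    (by
      rintro ⟨_, ψ, rfl⟩
      exact (hg ψ).le.trans (hl ψ))
  obtain ⟨F, hFm, hFi, hF⟩ := exists_density hs0 L
    fun ε hε => continuous_of_le_barrierGauge hs hK L hL2 hε
  refine ⟨F, hFm, hFi, fun ψ => ?_, fun G hG v d hv => ?_⟩
  · rw [← hF, ← hg ψ]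
    exact (hL1 (T.rangeRestrict ψ)).symm
  · rw [← hF ⟨G, hG⟩]
    exact (hL2 _).trans (mul_le_mul_of_nonneg_left (barrierGauge_le hv) hK)

/-- A vector field whose pairings are dominated by the gauge satisfies a weighted bound. -/
theorem exists_lintegral_norm_rpow_le [IsFiniteMeasure ν] (hs : 1 < s) (hK : 0 ≤ K)
    {F : Rn n → Rn n}
    (hFm : Measurable F)
    (hF : ∀ G ∈ boundedFields n, ∀ (v : Rn n → ℝ) (d : ℝ), IsBarrier R v d →
      ∫ x, inner ℝ (F x) (G x) ∂ν ≤ K * (weightedEnergy s ν G v + barrierEnergy s v d)) :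
    ∃ K' : ℝ, 0 ≤ K' ∧ ∀ (v : Rn n → ℝ) (d : ℝ), IsBarrier R v d →
      ∫⁻ x, ENNReal.ofReal (‖F x‖ ^ (s / (s - 1)) * v x ^ s) ∂ν ≤
        ENNReal.ofReal (K' * barrierEnergy s v d) := by
  have hs0 : 0 < s := by linarith
  have hs1 : 0 < s - 1 := by linarith
  set r := s / (s - 1) with hr
  have hr0 : 0 < r := by positivity
  have hr1 : (r - 1) * s = r := by rw [hr]; field_simp; ring
  have hr1' : 0 < r - 1 := by
    by_contra hcon
    nlinarith
  -- Solves κ^s = κ/(2(K+1)), so that K κ^s ≤ κ/2 and the weighted term can be absorbed on the left.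
  set κ := (1 / (2 * (K + 1))) ^ (1 / (s - 1)) with hκ
  have hκ0 : 0 < κ := by positivity
  have hκs : κ ^ s = κ / (2 * (K + 1)) := by
    have : κ ^ (s - 1) = 1 / (2 * (K + 1)) := by
      rw [hκ, ← Real.rpow_mul (by positivity), one_div_mul_cancel hs1.ne', Real.rpow_one]
    have e : κ ^ s = κ ^ (s - 1) * κ := by
      rw [← Real.rpow_add_one hκ0.ne', sub_add_cancel]
    rw [e, this]; ring
  refine ⟨2 * K / κ, by positivity, fun v d hv => ?_⟩
  obtain ⟨m, M, hm, hmM⟩ := hv.exists_bounds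
  -- The absorption needs a finite integral, so F is truncated at height k; Fatou's lemma removes
  -- the truncation with a bound independent of k.
  let A : ℕ → Set (Rn n) := fun k => {x | ‖F x‖ ≤ k}
  have hA : ∀ k, MeasurableSet (A k) := fun k => measurableSet_le hFm.norm measurable_const
  let f : Rn n → ℝ := fun x => ‖F x‖ ^ r * v x ^ s
  have hvm : Measurable v := hv.contDiff.continuous.measurable
  have hfm : Measurable f := (hFm.norm.pow_const r).mul (hvm.pow_const s)
  have hf0 : ∀ x, 0 ≤ f x := fun x => mul_nonneg (by positivity) (Real.rpow_nonneg (hv.pos x).le _)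
  have hM0 : 0 ≤ M := hm.le.trans ((hmM 0).1.trans (hmM 0).2)
  have htrunc : ∀ k, ∫⁻ x, ENNReal.ofReal ((A k).indicator f x) ∂ν ≤
      ENNReal.ofReal (2 * K / κ * barrierEnergy s v d) := by
    intro k
    -- The extremal field of the weighted Hölder inequality: by (r-1)s = r, both its pairing with F
    -- and its weighted energy are multiples of ∫|F|^r v^s over the truncation set.
    let G : Rn n → Rn n := (A k).indicator fun x => (κ * ‖F x‖ ^ (r - 2) * v x ^ s) • F x
    have hpow : ∀ x, ‖F x‖ ^ (r - 2) * ‖F x‖ = ‖F x‖ ^ (r - 1) := by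
      intro x
      rcases (norm_nonneg (F x)).eq_or_lt with h0 | h0
      · rw [← h0, mul_zero, Real.zero_rpow hr1'.ne']
      · rw [← Real.rpow_add_one h0.ne']; ring_nf
    have hGn : ∀ x ∈ A k, ‖G x‖ = κ * ‖F x‖ ^ (r - 1) * v x ^ s := by
      intro x hx
      have hp := hv.pos x
      simp only [G, Set.indicator_of_mem hx]
      rw [norm_smul, Real.norm_of_nonneg (by positivity), ← hpow x]
      ring
    have hG : G ∈ boundedFields n := by
      refine ⟨Measurable.indicator ?_ (hA k), κ * (k : ℝ) ^ (r - 1) * M ^ s, fun x => ?_⟩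
      · exact (((hFm.norm.pow_const (r - 2)).const_mul κ).mul (hvm.pow_const s)).smul hFm
      · by_cases hx : x ∈ A k
        · rw [hGn x hx]
          have hp := hv.pos x
          have h1 : ‖F x‖ ^ (r - 1) ≤ (k : ℝ) ^ (r - 1) :=
            Real.rpow_le_rpow (norm_nonneg _) hx hr1'.le
          have h2 : v x ^ s ≤ M ^ s := Real.rpow_le_rpow hp.le (hmM x).2 hs0.le
          gcongr
        · simp only [G, Set.indicator_of_notMem hx, norm_zero]
          positivity
    have hinner : ∀ x, inner ℝ (F x) (G x) = κ * (A k).indicator f x := by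
      intro x
      by_cases hx : x ∈ A k
      · simp only [G, Set.indicator_of_mem hx, f]
        rw [real_inner_smul_right, real_inner_self_eq_norm_sq]
        have : ‖F x‖ ^ (r - 2) * ‖F x‖ ^ 2 = ‖F x‖ ^ r := by
          rcases (norm_nonneg (F x)).eq_or_lt with h0 | h0
          · rw [← h0, Real.zero_rpow hr0.ne']; simp
          · rw [← Real.rpow_two, ← Real.rpow_add h0, sub_add_cancel]
        rw [← this]; ring
      · simp [G, hx]
    have hGs : ∀ x, ‖G x‖ ^ s * v x ^ (s - s ^ 2) = κ ^ s * (A k).indicator f x := by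
      intro x
      by_cases hx : x ∈ A k
      · have hp := hv.pos x
        rw [hGn x hx, Set.indicator_of_mem hx, Real.mul_rpow (by positivity) (by positivity),
          Real.mul_rpow hκ0.le (by positivity), ← Real.rpow_mul (norm_nonneg _), hr1,
          ← Real.rpow_mul hp.le, mul_assoc, ← Real.rpow_add hp, mul_assoc,
          show s * s + (s - s ^ 2) = s by ring]
      · simp [G, hx, Real.zero_rpow hs0.ne']
    have hI := hF G hG v d hv
    simp only [hinner, weightedEnergy, hGs] at hI
    rw [integral_const_mul, integral_const_mul, hκs] at hI
    have hint : Integrable ((A k).indicator f) ν := by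
      refine Integrable.of_bound (hfm.indicator (hA k)).aestronglyMeasurable
        ((k : ℝ) ^ r * M ^ s) (ae_of_all _ fun x => ?_)
      by_cases hx : x ∈ A k
      · rw [Set.indicator_of_mem hx, Real.norm_of_nonneg (hf0 x)]
        have hp := hv.pos x
        exact mul_le_mul (Real.rpow_le_rpow (norm_nonneg _) hx hr0.le)
          (Real.rpow_le_rpow hp.le (hmM x).2 hs0.le) (by positivity) (by positivity)
      · rw [Set.indicator_of_notMem hx, norm_zero]
        positivity
    have hind0 : ∀ x, 0 ≤ (A k).indicator f x := fun x => Set.indicator_nonneg (fun x _ => hf0 x) x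
    rw [← ofReal_integral_eq_lintegral_ofReal hint (ae_of_all _ hind0)]
    refine ENNReal.ofReal_le_ofReal ?_
    set I := ∫ x, (A k).indicator f x ∂ν
    have hI0 : 0 ≤ I := integral_nonneg hind0
    have h1 : K * (κ / (2 * (K + 1)) * I) ≤ κ / 2 * I := by
      have : K * (κ / (2 * (K + 1))) ≤ κ / 2 := by
        rw [mul_div_assoc', div_le_div_iff₀ (by positivity) two_pos]
        nlinarith
      calc _ = K * (κ / (2 * (K + 1))) * I := by ring
        _ ≤ _ := by gcongr
    rw [div_mul_eq_mul_div, le_div_iff₀ hκ0]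
    nlinarith
  calc ∫⁻ x, ENNReal.ofReal (f x) ∂ν
      = ∫⁻ x, liminf (fun k => ENNReal.ofReal ((A k).indicator f x)) atTop ∂ν := by
        refine lintegral_congr fun x => ?_
        have : Tendsto (fun k => ENNReal.ofReal ((A k).indicator f x)) atTop
            (𝓝 (ENNReal.ofReal (f x))) := by
          obtain ⟨N, hN⟩ := exists_nat_ge ‖F x‖
          refine tendsto_const_nhds.congr' ?_
          filter_upwards [eventually_ge_atTop N] with k hk
          have : x ∈ A k := hN.trans (by exact_mod_cast hk)
          rw [Set.indicator_of_mem this]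
        exact this.liminf_eq.symm
    _ ≤ liminf (fun k => ∫⁻ x, ENNReal.ofReal ((A k).indicator f x) ∂ν) atTop :=
        lintegral_liminf_le fun k => (hfm.indicator (hA k)).ennreal_ofReal
    _ ≤ liminf (fun _ : ℕ => ENNReal.ofReal (2 * K / κ * barrierEnergy s v d)) atTop :=
        liminf_le_liminf (Eventually.of_forall htrunc)
    _ = _ := liminf_const _

end duality

/-! ### Test functions and densities -/

section testFunctions

variable {n : ℕ} {Ω : Opens (Rn n)}

theorem contDiff_one_testFunction (ψ : 𝓓(Ω, ℝ)) : ContDiff ℝ 1 ψ :=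
  ψ.contDiff.of_le (by exact_mod_cast le_top)

theorem gradient_eq_zero_of_notMem_tsupport {ψ : Rn n → ℝ} {x : Rn n} (hx : x ∉ tsupport ψ) :
    gradient ψ x = 0 := by
  rw [gradient, fderiv_of_notMem_tsupport ℝ hx, map_zero]

theorem testFunction_eq_zero (ψ : 𝓓(Ω, ℝ)) {x : Rn n} (hx : x ∉ (Ω : Set (Rn n))) : ψ x = 0 :=
  image_eq_zero_of_notMem_tsupport fun h => hx (ψ.tsupport_subset h)

theorem gradient_testFunction_eq_zero (ψ : 𝓓(Ω, ℝ)) {x : Rn n} (hx : x ∉ (Ω : Set (Rn n))) :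
    gradient ψ x = 0 :=
  gradient_eq_zero_of_notMem_tsupport fun h => hx (ψ.tsupport_subset h)

theorem hasCompactSupport_gradient {ψ : Rn n → ℝ} (hψ : HasCompactSupport ψ) :
    HasCompactSupport (gradient ψ) :=
  (hψ.fderiv ℝ).comp_left (map_zero (InnerProductSpace.toDual ℝ (Rn n)).symm)

theorem gradient_mem_boundedFields {ψ : Rn n → ℝ} (hψ : ContDiff ℝ 1 ψ)
    (hψc : HasCompactSupport ψ) : gradient ψ ∈ boundedFields n :=
  ⟨(continuous_gradient hψ).measurable,
    (continuous_gradient hψ).bounded_above_of_compact_support (hasCompactSupport_gradient hψc)⟩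

theorem gradient_add_apply {f g : Rn n → ℝ} {x : Rn n} (hf : DifferentiableAt ℝ f x)
    (hg : DifferentiableAt ℝ g x) : gradient (f + g) x = gradient f x + gradient g x := by
  simp only [gradient, fderiv_add hf hg, map_add]

theorem gradient_const_smul_apply {f : Rn n → ℝ} {x : Rn n} (hf : DifferentiableAt ℝ f x) (c : ℝ) :
    gradient (c • f) x = c • gradient f x := by
  simp only [gradient, fderiv_const_smul hf, map_smul]

/-- The gradient as a linear map from test functions to bounded fields. -/
noncomputable def gradientField (Ω : Opens (Rn n)) : 𝓓(Ω, ℝ) →ₗ[ℝ] boundedFields n where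
  toFun ψ := ⟨gradient ψ,
    gradient_mem_boundedFields (contDiff_one_testFunction ψ) ψ.hasCompactSupport⟩
  map_add' ψ χ := by
    apply Subtype.ext
    ext1 x
    exact gradient_add_apply ((contDiff_one_testFunction ψ).differentiable one_ne_zero x)
      ((contDiff_one_testFunction χ).differentiable one_ne_zero x)
  map_smul' c ψ := by
    apply Subtype.ext
    ext1 x
    exact gradient_const_smul_apply ((contDiff_one_testFunction ψ).differentiable one_ne_zero x) c

/-- Integration of test functions against a finite measure. -/
noncomputable def integralFunctional (Ω : Opens (Rn n)) (μ : Measure (Rn n)) [IsFiniteMeasure μ] :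
    𝓓(Ω, ℝ) →ₗ[ℝ] ℝ where
  toFun ψ := ∫ x, ψ x ∂μ
  map_add' ψ χ := integral_add (ψ.continuous.integrable_of_hasCompactSupport ψ.hasCompactSupport)
    (χ.continuous.integrable_of_hasCompactSupport χ.hasCompactSupport)
  map_smul' _ _ := integral_const_mul _ _

end testFunctions

section densities

variable {n : ℕ} {Ω : Set (Rn n)} {s : ℝ} {g : Rn n → ℝ}

/-- The measure `g dx` on `Ω`. -/
noncomputable def densityMeasure (Ω : Set (Rn n)) (g : Rn n → ℝ) : Measure (Rn n) :=
  (volume.restrict Ω).withDensity fun x => ENNReal.ofReal (g x)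

theorem isFiniteMeasure_densityMeasure (hg : IntegrableOn g Ω) :
    IsFiniteMeasure (densityMeasure Ω g) :=
  isFiniteMeasure_withDensity_ofReal hg.2

theorem integral_densityMeasure (hg : IntegrableOn g Ω) (h0 : ∀ x, 0 ≤ g x) (f : Rn n → ℝ) :
    ∫ x, f x ∂densityMeasure Ω g = ∫ x in Ω, g x * f x := by
  rw [densityMeasure, integral_withDensity_eq_integral_toReal_smul₀
    hg.1.aemeasurable.ennreal_ofReal (ae_of_all _ fun x => ENNReal.ofReal_lt_top)]
  simp only [ENNReal.toReal_ofReal (h0 _), smul_eq_mul]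

theorem FunMemM.exists_traceInequality (i : Fin n) (hs : 1 < s) {R : ℝ} (hR : 0 ≤ R)
    (hΩ : MeasurableSet Ω) (h0 : ∀ x, 0 ≤ g x) (hg : FunMemM s Ω g) :
    ∃ C : ℝ, 0 ≤ C ∧ TraceInequality s R C (densityMeasure Ω g) := by
  obtain ⟨C, hC, h⟩ := hg.exists_lintegral_le (by linarith) h0
  have := isFiniteMeasure_densityMeasure hg.1
  refine exists_trace_inequality i hs hR hΩ ?_ hC fun K hK hKΩ => ?_
  · rw [densityMeasure, withDensity_apply _ hΩ.compl, Measure.restrict_restrict hΩ.compl]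
    simp
  · rw [densityMeasure, withDensity_apply _ hK.measurableSet,
      Measure.restrict_restrict_of_subset hKΩ]
    exact h K hK hKΩ

end densities

/-! ### From barrier bounds to capacity, and the field F -/

/-- The cut-off turns a competitor for the capacity on ℝⁿ into a function supported in a ball. The
price is the term |φ|^s, which the inhomogeneous capacity contains. -/
theorem integral_norm_fderiv_mul_le {n : ℕ} {s B : ℝ} (hs : 1 < s) {χ φ : Rn n → ℝ}
    (hχ : ContDiff ℝ 1 χ) (hχ1 : ∀ x, |χ x| ≤ 1) (hχB : ∀ x, ‖fderiv ℝ χ x‖ ≤ B)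
    (hφ : ContDiff ℝ 1 φ) (hφc : HasCompactSupport φ) :
    ∫ x, ‖fderiv ℝ (fun x => χ x * φ x) x‖ ^ s ≤
      2 ^ s * (1 + B ^ s) * ∫ x, (‖fderiv ℝ φ x‖ ^ s + |φ x| ^ s) := by
  have hs0 : 0 < s := by linarith
  have hB : 0 ≤ B := (norm_nonneg _).trans (hχB 0)
  have hc : HasCompactSupport fun x => χ x * φ x := hφc.mul_left
  have hi : Integrable (fun x => ‖fderiv ℝ φ x‖ ^ s + |φ x| ^ s) (volume : Measure (Rn n)) :=
    (integrable_rpow_of_compactSupport hs0 (hφ.continuous_fderiv one_ne_zero) (hφc.fderiv ℝ)).add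
      (integrable_rpow_of_compactSupport hs0 hφ.continuous hφc)
  rw [← integral_const_mul]
  refine integral_mono (integrable_rpow_of_compactSupport hs0
    ((hχ.mul hφ).continuous_fderiv one_ne_zero) (hc.fderiv ℝ)) (hi.const_mul _) fun x => ?_
  have hn : ‖fderiv ℝ (fun x => χ x * φ x) x‖ ≤ ‖fderiv ℝ φ x‖ + B * |φ x| := by
    rw [fderiv_fun_mul (hχ.differentiable one_ne_zero x) (hφ.differentiable one_ne_zero x)]
    refine (norm_add_le _ _).trans ?_
    rw [norm_smul, norm_smul, Real.norm_eq_abs, Real.norm_eq_abs]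
    have h1 := mul_le_mul_of_nonneg_right (hχ1 x) (norm_nonneg (fderiv ℝ φ x))
    have h2 := mul_le_mul_of_nonneg_right (hχB x) (abs_nonneg (φ x))
    linarith
  refine (Real.rpow_le_rpow (norm_nonneg _) hn hs0.le).trans
    ((add_rpow_le_two_rpow_mul hs0.le (norm_nonneg _) (by positivity)).trans ?_)
  rw [Real.mul_rpow hB (abs_nonneg _), mul_assoc]
  have h1 : 0 ≤ ‖fderiv ℝ φ x‖ ^ s := by positivity
  have h2 : 0 ≤ |φ x| ^ s := by positivity
  have h3 : 0 ≤ B ^ s := by positivity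
  gcongr
  nlinarith [mul_nonneg h3 h1]

/-- A weighted bound in terms of barriers implies domination by the capacity. -/
theorem funMemM_of_barrier_bound {n : ℕ} {s R₀ K : ℝ} (hs : 1 < s) (hR₀ : 0 < R₀) (hK : 0 ≤ K)
    {Ω : Set (Rn n)} (hΩ : MeasurableSet Ω) (hΩR : Ω ⊆ Metric.closedBall 0 R₀) {g : Rn n → ℝ}
    (h0 : ∀ x, 0 ≤ g x) (hgm : Measurable g)
    (h : ∀ (v : Rn n → ℝ) (d : ℝ), IsBarrier (R₀ + 1) v d →
      ∫⁻ x in Ω, ENNReal.ofReal (g x * v x ^ s) ≤ ENNReal.ofReal (K * barrierEnergy s v d)) :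
    FunMemM s Ω g := by
  have hs0 : 0 < s := by linarith
  have hint : IntegrableOn g Ω := by
    refine ⟨hgm.aestronglyMeasurable, ?_⟩
    rw [hasFiniteIntegral_iff_ofReal (ae_of_all _ h0)]
    -- The barrier v = 1 already yields integrability.
    have := h (fun _ => 1) 1 (IsBarrier.const one_pos)
    simp only [Real.one_rpow, mul_one] at this
    exact this.trans_lt ENNReal.ofReal_lt_top
  -- Equal to 1 on the ball containing Ω, so that χφ ≥ 1 on the compact set T.
  let χ : ContDiffBump (0 : Rn n) := ⟨R₀, R₀ + 1, hR₀, by linarith⟩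
  have hχ : ContDiff ℝ ∞ χ := χ.contDiff
  obtain ⟨B, hB⟩ := (hχ.continuous_fderiv (by simp)).bounded_above_of_compact_support
    (χ.hasCompactSupport.fderiv ℝ)
  have hB0 : 0 ≤ B := (norm_nonneg _).trans (hB 0)
  set c := K * (2 ^ s * (1 + B ^ s)) with hc
  have hc0 : 0 ≤ c := by positivity
  -- The constant is c + 1, not c, so that it can be divided out before passing to the infimum over
  -- φ.
  refine funMemM_of_lintegral_le hΩ h0 hint (C := ENNReal.ofReal (c + 1)) ENNReal.ofReal_ne_top
    fun T hT hTΩ => ?_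
  rw [mul_comm, ← ENNReal.div_le_iff (by simpa using by linarith) ENNReal.ofReal_ne_top]
  refine le_iInf fun φ => le_iInf fun hφ => le_iInf fun hφc => le_iInf fun hφT => ?_
  rw [ENNReal.div_le_iff (by simpa using by linarith) ENNReal.ofReal_ne_top]
  have hφ0 : ∀ x, 0 ≤ φ x := fun x =>
    (Set.indicator_nonneg (fun _ _ => zero_le_one) x).trans (hφT x)
  have hφ1 : ContDiff ℝ 1 φ := hφ.of_le (by exact_mod_cast le_top)
  have hχ1 : ContDiff ℝ 1 χ := hχ.of_le (by exact_mod_cast le_top)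
  have hχφ : ContDiff ℝ 1 fun x => χ x * φ x := hχ1.mul hφ1
  have hχs : tsupport (fun x => χ x * φ x) ⊆ Metric.closedBall 0 (R₀ + 1) :=
    tsupport_subset_closedBall fun x hx => by
      rw [χ.zero_of_le_dist (by simpa using (not_le.1 fun h => hx (by simpa using h)).le), zero_mul]
  set E := ∫ x, ‖fderiv ℝ (fun x => χ x * φ x) x‖ ^ s with hE
  -- A barrier has to be strictly positive, hence the shift of χφ by d, which is then sent to 0.
  have hd : ∀ d : ℝ, 0 < d →
      ∫⁻ x in T, ENNReal.ofReal (g x) ≤ ENNReal.ofReal (K * (E + d ^ s)) := by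
    intro d hd
    have hv : IsBarrier (R₀ + 1) (fun x => d + χ x * φ x) d :=
      (IsBarrier.const hd).add_of_nonneg hχφ (fun x => mul_nonneg χ.nonneg (hφ0 x)) hχs
    have h1 := h _ d hv
    have h2 : barrierEnergy s (fun x => d + χ x * φ x) d = E + d ^ s := by
      rw [barrierEnergy, hE]
      simp only [fderiv_const_add]
    rw [h2] at h1
    refine le_trans ?_ h1
    refine (setLIntegral_mono' hT.measurableSet fun x hx => ?_).trans
      (lintegral_mono_set (f := fun x => ENNReal.ofReal (g x * (d + χ x * φ x) ^ s)) hTΩ)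
    refine ENNReal.ofReal_le_ofReal (le_mul_of_one_le_right (h0 x) (Real.one_le_rpow ?_ hs0.le))
    have h3 := hφT x
    rw [Set.indicator_of_mem hx] at h3
    rw [χ.one_of_mem_closedBall (hΩR (hTΩ hx)), one_mul]
    linarith
  have hlim : Tendsto (fun d : ℝ => ENNReal.ofReal (K * (E + d ^ s))) (𝓝[>] 0)
      (𝓝 (ENNReal.ofReal (K * (E + 0 ^ s)))) := by
    refine ENNReal.tendsto_ofReal (tendsto_nhdsWithin_of_tendsto_nhds ?_)
    exact ((Real.continuousAt_rpow_const 0 s (Or.inr hs0.le)).tendsto.const_add E).const_mul K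
  have hX := ge_of_tendsto hlim (eventually_mem_nhdsWithin.mono fun d hd' => hd d hd')
  rw [Real.zero_rpow hs0.ne', add_zero] at hX
  have hEle := integral_norm_fderiv_mul_le hs hχ1
    (fun x => by rw [abs_of_nonneg χ.nonneg]; exact χ.le_one) hB hφ1 hφc
  have hi : Integrable (fun x => ‖fderiv ℝ φ x‖ ^ s + |φ x| ^ s) (volume : Measure (Rn n)) :=
    (integrable_rpow_of_compactSupport hs0 (hφ1.continuous_fderiv one_ne_zero)
      (hφc.fderiv ℝ)).add (integrable_rpow_of_compactSupport hs0 hφ1.continuous hφc)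
  have hconv : ∫⁻ x, ENNReal.ofReal (‖gradient φ x‖ ^ s + φ x ^ s) =
      ENNReal.ofReal (∫ x, (‖fderiv ℝ φ x‖ ^ s + |φ x| ^ s)) := by
    rw [ofReal_integral_eq_lintegral_ofReal hi (ae_of_all _ fun x => by positivity)]
    exact lintegral_congr fun x => by rw [norm_gradient, abs_of_nonneg (hφ0 x)]
  rw [hconv, ← ENNReal.ofReal_mul (integral_nonneg fun x => by positivity)]
  refine hX.trans (ENNReal.ofReal_le_ofReal ?_)
  have h4 := mul_le_mul_of_nonneg_left hEle hK
  have h5 : 0 ≤ ∫ x, (‖fderiv ℝ φ x‖ ^ s + |φ x| ^ s) := integral_nonneg fun x => by positivity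
  rw [hc]
  nlinarith

/-- Every nonnegative density in `M^{1,s}(Ω)` is the divergence (up to sign) of a vector field
whose dual power is again in `M^{1,s}(Ω)`. -/
theorem FunMemM.exists_field {n : ℕ} (i : Fin n) {s R₀ : ℝ} (hs : 1 < s) (hR₀ : 0 < R₀)
    {Ω : Opens (Rn n)} (hΩR : (Ω : Set (Rn n)) ⊆ Metric.closedBall 0 R₀) {g : Rn n → ℝ}
    (h0 : ∀ x, 0 ≤ g x) (hg : FunMemM s Ω g) :
    ∃ F : Rn n → Rn n, Measurable F ∧
      (∀ ψ : 𝓓(Ω, ℝ), ∫ x in (Ω : Set (Rn n)), g x * ψ x =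
        ∫ x in (Ω : Set (Rn n)), inner ℝ (F x) (gradient ψ x)) ∧
      FunMemM s Ω fun x => ‖F x‖ ^ (s / (s - 1)) := by
  have hΩm : MeasurableSet (Ω : Set (Rn n)) := Ω.isOpen.measurableSet
  have := isFiniteMeasure_densityMeasure hg.1
  have hfin : IsFiniteMeasure (volume.restrict (Ω : Set (Rn n))) :=
    isFiniteMeasure_restrict.2
      ((measure_mono hΩR).trans_lt (isCompact_closedBall (0 : Rn n) R₀).measure_lt_top).ne
  have hR : 0 ≤ R₀ + 1 := by linarith
  obtain ⟨C, hC, htr⟩ := hg.exists_traceInequality i hs hR hΩm h0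
  obtain ⟨K, hK, hdual⟩ := htr.exists_dual_estimate hs hC
  obtain ⟨F, hFm, hFi, hF, hFG⟩ := exists_dual_field (ν := volume.restrict (Ω : Set (Rn n)))
    (R := R₀ + 1) hs hK (gradientField Ω) (integralFunctional Ω (densityMeasure Ω g)) (by
      intro ψ v d hv
      have hψs : tsupport ψ ⊆ Metric.closedBall 0 (R₀ + 1) :=
        ψ.tsupport_subset.trans (hΩR.trans (Metric.closedBall_subset_closedBall (by linarith)))
      have h1 := hdual ψ v d (contDiff_one_testFunction ψ) hψs hv
      have h2 : weightedEnergy s (volume.restrict (Ω : Set (Rn n))) (gradientField Ω ψ) v =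
          ∫ x, ‖fderiv ℝ ψ x‖ ^ s * v x ^ (s - s ^ 2) := by
        have e : ∀ x, ‖fderiv ℝ ψ x‖ ^ s * v x ^ (s - s ^ 2) =
            ‖gradient ψ x‖ ^ s * v x ^ (s - s ^ 2) := fun x => by rw [norm_gradient]
        simp_rw [e]
        refine setIntegral_eq_integral_of_forall_compl_eq_zero fun x hx => ?_
        rw [show (gradientField Ω ψ : Rn n → Rn n) x = 0 from gradient_testFunction_eq_zero ψ hx,
          norm_zero, Real.zero_rpow (by linarith), zero_mul]
      rw [h2]
      refine le_trans ?_ h1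
      exact integral_mono (ψ.continuous.integrable_of_hasCompactSupport ψ.hasCompactSupport)
        (ψ.continuous.integrable_of_hasCompactSupport ψ.hasCompactSupport).abs
        fun x => le_abs_self _)
  obtain ⟨K', hK', hbound⟩ := exists_lintegral_norm_rpow_le hs hK hFm hFG
  refine ⟨F, hFm, fun ψ => ?_, ?_⟩
  · rw [← integral_densityMeasure hg.1 h0]
    exact hF ψ
  · exact funMemM_of_barrier_bound hs hR₀ hK' hΩm hΩR (fun x => by positivity)
      (hFm.norm.pow_const _) hbound

/-! ### Pairing of div f with W₀^{1,s} -/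

section pairing

variable {n : ℕ} {Ω : Opens (Rn n)} {r s : ℝ}

theorem integral_smul_gradient_eq_neg {v φ : Rn n → ℝ} (hv : ContDiff ℝ 1 v)
    (hφ : ContDiff ℝ 1 φ) (hφc : HasCompactSupport φ) :
    ∫ x, v x • gradient φ x = -∫ x, φ x • gradient v x := by
  have h1 : Integrable fun x => v x • gradient φ x :=
    (hv.continuous.smul (continuous_gradient hφ)).integrable_of_hasCompactSupport
      (hasCompactSupport_gradient hφc).smul_left
  have h2 : Integrable fun x => φ x • gradient v x :=
    (hφ.continuous.smul (continuous_gradient hv)).integrable_of_hasCompactSupport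
      hφc.smul_right
  refine ext_inner_left ℝ fun w => ?_
  rw [inner_neg_right, ← integral_inner h1, ← integral_inner h2]
  have e : ∀ f : Rn n → ℝ, ∀ x, inner ℝ w (gradient f x) = fderiv ℝ f x w := fun f x => by
    rw [real_inner_comm, inner_gradient_left]
  simp only [inner_smul_right, e]
  have hc : ∀ f : Rn n → ℝ, ContDiff ℝ 1 f → Continuous fun x => fderiv ℝ f x w := fun f hf =>
    (hf.continuous_fderiv one_ne_zero).clm_apply continuous_const
  rw [integral_mul_fderiv_eq_neg_fderiv_mul_of_integrable]
  · simp only [mul_comm]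
  · exact ((hc v hv).mul hφ.continuous).integrable_of_hasCompactSupport hφc.mul_left
  · exact (hv.continuous.mul (hc φ hφ)).integrable_of_hasCompactSupport
      (hφc.fderiv_apply ℝ w).mul_left
  · exact (hv.continuous.mul hφ.continuous).integrable_of_hasCompactSupport hφc.mul_left
  · exact fun x _ => hv.differentiable one_ne_zero x
  · exact fun x _ => hφ.differentiable one_ne_zero x

theorem memSobolev_gradient {v : Rn n → ℝ} (hv : ContDiff ℝ 1 v) (hvc : HasCompactSupport v) :
    MemSobolev Ω r v (gradient v) := by
  refine ⟨hv.continuous.memLp_of_hasCompactSupport hvc,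
    (continuous_gradient hv).memLp_of_hasCompactSupport (hasCompactSupport_gradient hvc),
    hv.continuous.locallyIntegrable.locallyIntegrableOn _,
    (continuous_gradient hv).locallyIntegrable.locallyIntegrableOn _, fun φ => ?_⟩
  rw [setIntegral_eq_integral_of_forall_compl_eq_zero fun x hx => by
      rw [gradient_testFunction_eq_zero φ hx, smul_zero],
    setIntegral_eq_integral_of_forall_compl_eq_zero fun x hx => by
      rw [testFunction_eq_zero φ hx, zero_smul]]
  exact integral_smul_gradient_eq_neg hv (contDiff_one_testFunction φ) φ.hasCompactSupport

/-- A `C¹` function with compact support in `Ω` belongs to `W_0^{1,s}(Ω)`. -/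
theorem memSobolevZero_of_contDiff {v : Rn n → ℝ} (hv : ContDiff ℝ 1 v)
    (hvc : HasCompactSupport v) (hvΩ : tsupport v ⊆ Ω)
    [IsFiniteMeasure (volume.restrict (Ω : Set (Rn n)))] : MemSobolevZero Ω s v := by
  -- Mollifying within distance ρ keeps the supports inside Ω; uniform convergence of values and
  -- gradients gives W^{1,s} convergence, as Ω has finite measure.
  obtain ⟨ρ, hρ, hρΩ⟩ := hvc.isCompact.exists_cthickening_subset_open Ω.isOpen hvΩ
  have happrox := fun k : ℕ =>
    exists_smooth_approx hv hvc (Nat.one_div_pos_of_nat (α := ℝ) (n := k)) hρ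
  choose ψ hψ hψs hψv hψd using happrox
  have hψc : ∀ k, HasCompactSupport (ψ k) := fun k =>
    (hvc.isCompact.cthickening).of_isClosed_subset (isClosed_tsupport _) (hψs k)
  have hlim : Tendsto (fun k : ℕ => volume.restrict (Ω : Set (Rn n)) Set.univ ^
      (ENNReal.ofReal s).toReal⁻¹ * ENNReal.ofReal (1 / ((k : ℝ) + 1))) atTop (𝓝 0) := by
    have h1 : Tendsto (fun k : ℕ => ENNReal.ofReal (1 / ((k : ℝ) + 1))) atTop (𝓝 0) := by
      simpa using ENNReal.tendsto_ofReal tendsto_one_div_add_atTop_nhds_zero_nat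
    have h2 := ENNReal.Tendsto.const_mul (a := volume.restrict (Ω : Set (Rn n)) Set.univ ^
      (ENNReal.ofReal s).toReal⁻¹) h1
      (Or.inr (ENNReal.rpow_ne_top_of_nonneg (by positivity) (measure_ne_top _ _)))
    simpa using h2
  refine ⟨fun k => ⟨ψ k, hψ k, hψc k, (hψs k).trans hρΩ⟩, gradient v,
    memSobolev_gradient hv hvc, ?_, ?_⟩
  · exact tendsto_of_tendsto_of_tendsto_of_le_of_le tendsto_const_nhds hlim (fun _ => zero_le)
      fun k => eLpNorm_le_of_ae_bound (ae_of_all _ fun x => hψv k x)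
  · refine tendsto_of_tendsto_of_tendsto_of_le_of_le tendsto_const_nhds hlim (fun _ => zero_le)
      fun k => eLpNorm_le_of_ae_bound (ae_of_all _ fun x => ?_)
    refine le_trans (le_of_eq ?_) (hψd k x)
    change ‖gradient (ψ k) x - gradient v x‖ = _
    rw [gradient, gradient, ← map_sub, LinearIsometryEquiv.norm_map]

/-- Weak gradients are unique almost everywhere. -/
theorem IsWeakGradient.ae_eq {v : Rn n → ℝ} {G H : Rn n → Rn n} (hG : IsWeakGradient Ω v G)
    (hH : IsWeakGradient Ω v H) (hGi : IntegrableOn G Ω) (hHi : IntegrableOn H Ω) :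
    ∀ᵐ x ∂volume.restrict (Ω : Set (Rn n)), G x = H x := by
  rw [ae_restrict_iff' Ω.isOpen.measurableSet]
  have := Ω.isOpen.ae_eq_zero_of_integral_contDiff_smul_eq_zero (μ := volume)
    (f := fun x => G x - H x) (hG.2.1.sub hH.2.1) fun g hg hgc hgΩ => by
      let φ : 𝓓(Ω, ℝ) := ⟨g, hg, hgc, hgΩ⟩
      obtain ⟨C, hC⟩ := hg.continuous.bounded_above_of_compact_support hgc
      have hi : ∀ F : Rn n → Rn n, IntegrableOn F Ω → IntegrableOn (fun x => g x • F x) Ω :=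
        fun F hF => hF.bdd_smul C hg.continuous.aestronglyMeasurable (ae_of_all _ hC)
      rw [← setIntegral_eq_integral_of_forall_compl_eq_zero (s := (Ω : Set (Rn n))) fun x hx => by
        rw [show g x = 0 from testFunction_eq_zero φ hx, zero_smul]]
      simp only [smul_sub]
      rw [integral_sub (hi G hGi) (hi H hHi)]
      have h1 := (hG.2.2 φ).symm.trans (hH.2.2 φ)
      exact sub_eq_zero.2 (neg_injective h1)
  filter_upwards [this] with x hx hxΩ using sub_eq_zero.1 (hx hxΩ)

/-- Hölder's inequality for the integral of an inner product. -/
theorem enorm_integral_inner_le (hrs : r.HolderConjugate s) {ν : Measure (Rn n)}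
    {f G : Rn n → Rn n} (hf : AEStronglyMeasurable f ν) (hG : AEStronglyMeasurable G ν) :
    ‖∫ x, inner ℝ (f x) (G x) ∂ν‖ₑ ≤
      eLpNorm f (ENNReal.ofReal r) ν * eLpNorm G (ENNReal.ofReal s) ν := by
  have := hrs.ennrealOfReal
  refine (enorm_integral_le_lintegral_enorm _).trans ?_
  rw [← eLpNorm_one_eq_lintegral_enorm]
  have h := eLpNorm_le_eLpNorm_mul_eLpNorm'_of_norm (r := 1) (p := ENNReal.ofReal r)
    (q := ENNReal.ofReal s) hf hG (fun a b => inner ℝ a b) 1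
    (ae_of_all _ fun x => by simpa using norm_inner_le_norm (𝕜 := ℝ) (f x) (G x))
  simpa using h

/-- By Hölder the error is at most the L^r norm of f times the L^s norm of ∇φ_k - Dv. Uniqueness of
weak gradients identifies Dv with ∇v, so the limit does not depend on the sequence. Only C¹
regularity is asked, because |φ|^s need not be smooth. -/
theorem hasPairing_of_contDiff (hrs : r.HolderConjugate s)
    [IsFiniteMeasure (volume.restrict (Ω : Set (Rn n)))] {σ : 𝓓'(Ω, ℝ)} {f : Rn n → Rn n}
    (hf : MemLp f (ENNReal.ofReal r) (volume.restrict (Ω : Set (Rn n)))) (hσ : IsDiv Ω σ f)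
    {v : Rn n → ℝ} (hv : ContDiff ℝ 1 v) (hvc : HasCompactSupport v) (hvΩ : tsupport v ⊆ Ω) :
    HasPairing Ω s σ v (-∫ x in (Ω : Set (Rn n)), inner ℝ (f x) (gradient v x)) := by
  have hs1 : (1 : ℝ≥0∞) ≤ ENNReal.ofReal s := by
    simpa using ENNReal.ofReal_le_ofReal hrs.symm.lt.le
  have hint : ∀ {H : Rn n → Rn n}, MemLp H (ENNReal.ofReal s) (volume.restrict (Ω : Set (Rn n))) →
      IntegrableOn (fun x => inner ℝ (f x) (H x)) Ω := fun {H} hH => by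
    have := hrs.ennrealOfReal
    exact memLp_one_iff_integrable.1 (hf.of_bilin (r := 1) (fun a b => inner ℝ a b) 1 hH
      (hf.1.inner hH.1) (ae_of_all _ fun x => by
        simpa using nnnorm_inner_le_nnnorm (𝕜 := ℝ) (f x) (H x)))
  refine ⟨memSobolevZero_of_contDiff hv hvc hvΩ, fun φ ⟨Dv, hDv, _, hlim⟩ => ?_⟩
  have hDv' := memSobolev_gradient (Ω := Ω) (r := s) hv hvc
  have hae := hDv.2.2.ae_eq hDv'.2.2 (hDv.2.1.integrable hs1) (hDv'.2.1.integrable hs1)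
  have hφg : ∀ k, MemLp (gradient (φ k)) (ENNReal.ofReal s)
      (volume.restrict (Ω : Set (Rn n))) := fun k =>
    (memSobolev_gradient (contDiff_one_testFunction (φ k)) (φ k).hasCompactSupport).2.1
  have hbound : ∀ k, ‖σ (φ k) - -∫ x in (Ω : Set (Rn n)), inner ℝ (f x) (gradient v x)‖ₑ ≤
      eLpNorm f (ENNReal.ofReal r) (volume.restrict (Ω : Set (Rn n))) *
        eLpNorm (fun x => gradient (φ k) x - Dv x) (ENNReal.ofReal s)
          (volume.restrict (Ω : Set (Rn n))) := fun k => by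
    rw [eLpNorm_congr_ae (f := fun x => gradient (φ k) x - Dv x)
      (g := fun x => gradient (φ k) x - gradient v x)
      (hae.mono fun x hx => by simp only [hx])]
    refine le_trans (le_of_eq ?_) (enorm_integral_inner_le hrs hf.1 ((hφg k).sub hDv'.2.1).1)
    rw [hσ.2 (φ k), ← enorm_neg]
    simp only [inner_sub_right]
    rw [integral_sub (hint (hφg k)) (hint hDv'.2.1)]
    congr 1
    ring
  rw [tendsto_iff_enorm_sub_tendsto_zero]
  refine tendsto_of_tendsto_of_tendsto_of_le_of_le tendsto_const_nhds ?_ (fun _ => zero_le) hbound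
  simpa using ENNReal.Tendsto.const_mul hlim (Or.inr hf.2.ne)

/-- Hölder's inequality, with the L^r norm of f as the constant. -/
theorem IsDiv.memNegSobolev (hr : 1 < r) {σ : 𝓓'(Ω, ℝ)} {f : Rn n → Rn n}
    (hf : MemLp f (ENNReal.ofReal r) (volume.restrict (Ω : Set (Rn n)))) (hσ : IsDiv Ω σ f) :
    MemNegSobolev Ω r σ := by
  have hrs := Real.HolderConjugate.conjExponent hr
  set s := r.conjExponent
  have hs : 0 < s := hrs.symm.pos
  refine ⟨(eLpNorm f (ENNReal.ofReal r) (volume.restrict (Ω : Set (Rn n)))).toReal, fun φ => ?_⟩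
  have hφ := memSobolev_gradient (Ω := Ω) (r := s) (contDiff_one_testFunction φ)
    φ.hasCompactSupport
  have hp : ENNReal.ofReal s ≠ 0 := by simpa using hs
  have h1 := enorm_integral_inner_le hrs hf.1 hφ.2.1.1
  have h2 := ENNReal.toReal_mono (ENNReal.mul_ne_top hf.2.ne hφ.2.1.2.ne) h1
  rw [toReal_enorm, Real.norm_eq_abs, ENNReal.toReal_mul,
    hφ.2.1.eLpNorm_eq_integral_rpow_norm hp ENNReal.ofReal_ne_top, ENNReal.toReal_ofReal hs.le,
    ENNReal.toReal_ofReal (by positivity), ← one_div] at h2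
  rw [hσ.2 φ, abs_neg]
  refine h2.trans ?_
  have hi : ∀ {E : Type} [NormedAddCommGroup E] {g : Rn n → E},
      MemLp g (ENNReal.ofReal s) (volume.restrict (Ω : Set (Rn n))) →
      IntegrableOn (fun x => ‖g x‖ ^ s) Ω := fun hg => by
    simpa [ENNReal.toReal_ofReal hs.le, IntegrableOn] using
      hg.integrable_norm_rpow hp ENNReal.ofReal_ne_top
  refine mul_le_mul_of_nonneg_left (Real.rpow_le_rpow (integral_nonneg fun x => by positivity)
    (integral_mono (hi hφ.2.1) ((hi hφ.1).add (hi hφ.2.1)) fun x => ?_) (by positivity))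
    ENNReal.toReal_nonneg
  exact le_add_of_nonneg_left (by positivity)

end pairing

/-- Membership passes to smaller functions since only the integral over compact sets matters. Two
majorants are allowed because the r-th power of a difference of fields is bounded by a sum. -/
theorem FunMemM.of_ae_le {n : ℕ} {s c : ℝ} (hs : 0 ≤ s) (hc : 0 ≤ c) {Ω : Set (Rn n)}
    (hΩ : MeasurableSet Ω) {f g₁ g₂ : Rn n → ℝ} (hf : ∀ x, 0 ≤ f x)
    (hfm : AEStronglyMeasurable f (volume.restrict Ω)) (h₁ : ∀ x, 0 ≤ g₁ x) (h₂ : ∀ x, 0 ≤ g₂ x)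
    (hg₁ : FunMemM s Ω g₁) (hg₂ : FunMemM s Ω g₂)
    (h : ∀ᵐ x ∂volume.restrict Ω, f x ≤ c * (g₁ x + g₂ x)) : FunMemM s Ω f := by
  obtain ⟨C₁, hC₁, hb₁⟩ := hg₁.exists_lintegral_le hs h₁
  obtain ⟨C₂, hC₂, hb₂⟩ := hg₂.exists_lintegral_le hs h₂
  refine funMemM_of_lintegral_le hΩ hf
    (((hg₁.1.add hg₂.1).const_mul c).mono' hfm (h.mono fun x hx => ?_))
    (C := ENNReal.ofReal c * (C₁ + C₂))
    (ENNReal.mul_ne_top ENNReal.ofReal_ne_top (ENNReal.add_ne_top.2 ⟨hC₁, hC₂⟩))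
    fun K hK hKΩ => ?_
  · rw [Real.norm_of_nonneg (hf x)]
    exact hx
  · calc ∫⁻ x in K, ENNReal.ofReal (f x)
        ≤ ∫⁻ x in K, ENNReal.ofReal c * (ENNReal.ofReal (g₁ x) + ENNReal.ofReal (g₂ x)) := by
          refine lintegral_mono_ae ((ae_restrict_of_ae_restrict_of_subset hKΩ h).mono
            fun x hx => ?_)
          rw [← ENNReal.ofReal_add (h₁ x) (h₂ x), ← ENNReal.ofReal_mul hc]
          exact ENNReal.ofReal_le_ofReal hx
      _ = ENNReal.ofReal c * ((∫⁻ x in K, ENNReal.ofReal (g₁ x)) +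
            ∫⁻ x in K, ENNReal.ofReal (g₂ x)) := by
          rw [lintegral_const_mul' _ _ ENNReal.ofReal_ne_top, lintegral_add_left'
            (hg₁.1.1.aemeasurable.ennreal_ofReal.mono_measure (Measure.restrict_mono hKΩ le_rfl))]
      _ ≤ ENNReal.ofReal c * (C₁ * cap s K + C₂ * cap s K) := by
          gcongr
          · exact hb₁ K hK hKΩ
          · exact hb₂ K hK hKΩ
      _ = ENNReal.ofReal c * (C₁ + C₂) * cap s K := by ring

/-! ### The bound for ⟨σ, |φ|^s⟩ -/

section pairingBound

variable {n : ℕ} {r s : ℝ}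

theorem norm_gradient_abs_rpow (hs : 1 < s) {φ : Rn n → ℝ} (hφ : Differentiable ℝ φ) (x : Rn n) :
    ‖gradient (fun x => |φ x| ^ s) x‖ = s * |φ x| ^ (s - 1) * ‖gradient φ x‖ := by
  rw [norm_gradient, norm_gradient, (hasFDerivAt_abs_rpow hs hφ x).fderiv, norm_smul]
  congr 1
  rw [Real.norm_eq_abs, abs_mul, abs_mul, abs_of_pos (by linarith : 0 < s),
    abs_of_nonneg (by positivity : 0 ≤ |φ x| ^ (s - 2)), mul_assoc]
  congr 1
  rcases (abs_nonneg (φ x)).eq_or_lt with h | h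
  · rw [← h, mul_zero, Real.zero_rpow (by linarith)]
  · rw [← Real.rpow_add_one h.ne']
    congr 1
    ring

/-- Young's inequality for |y||φ|^(s-1) and |∇φ|; since (s-1)r = s, the first factor becomes
|y|^r|φ|^s, the integrand of the trace inequality. -/
theorem abs_inner_gradient_abs_rpow_le (hrs : r.HolderConjugate s) {φ : Rn n → ℝ}
    (hφ : Differentiable ℝ φ) (y x : Rn n) :
    |inner ℝ y (gradient (fun x => |φ x| ^ s) x)| ≤
      s * (‖y‖ ^ r * |φ x| ^ s + ‖gradient φ x‖ ^ s) := by
  have hs : 1 < s := hrs.symm.lt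
  refine (abs_real_inner_le_norm _ _).trans ?_
  rw [norm_gradient_abs_rpow hs hφ]
  have hy := Real.young_inequality_of_nonneg (a := ‖y‖ * |φ x| ^ (s - 1)) (b := ‖gradient φ x‖)
    (by positivity) (norm_nonneg _) hrs
  have e : (‖y‖ * |φ x| ^ (s - 1)) ^ r = ‖y‖ ^ r * |φ x| ^ s := by
    rw [Real.mul_rpow (norm_nonneg _) (by positivity), ← Real.rpow_mul (abs_nonneg _),
      hrs.symm.sub_one_mul_conj]
  rw [e] at hy
  have h1 : ‖y‖ ^ r * |φ x| ^ s / r ≤ ‖y‖ ^ r * |φ x| ^ s :=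
    div_le_self (by positivity) hrs.lt.le
  have h2 : ‖gradient φ x‖ ^ s / s ≤ ‖gradient φ x‖ ^ s := div_le_self (by positivity) hs.le
  calc ‖y‖ * (s * |φ x| ^ (s - 1) * ‖gradient φ x‖)
      = s * (‖y‖ * |φ x| ^ (s - 1) * ‖gradient φ x‖) := by ring
    _ ≤ _ := mul_le_mul_of_nonneg_left (by linarith) (by linarith)

theorem exists_integral_inner_gradient_abs_rpow_le (i : Fin n) (hrs : r.HolderConjugate s)
    {R : ℝ} (hR : 0 ≤ R) {Ω : Opens (Rn n)} (hΩR : (Ω : Set (Rn n)) ⊆ Metric.closedBall 0 R)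
    {f : Rn n → Rn n} (hf : FunMemM s Ω fun x => ‖f x‖ ^ r) :
    ∃ C : ℝ, ∀ φ : 𝓓(Ω, ℝ),
      |∫ x in (Ω : Set (Rn n)), inner ℝ (f x) (gradient (fun x => |φ x| ^ s) x)| ≤
        C * ∫ x in (Ω : Set (Rn n)), ‖gradient φ x‖ ^ s := by
  have hs : 1 < s := hrs.symm.lt
  have hs0 : 0 < s := by linarith
  obtain ⟨C, -, htr⟩ := hf.exists_traceInequality i hs hR Ω.isOpen.measurableSet
    fun x => by positivity
  refine ⟨s * (C + 1), fun φ => ?_⟩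
  have hφ := contDiff_one_testFunction φ
  have h1 := htr φ hφ (φ.tsupport_subset.trans hΩR)
  rw [integral_densityMeasure hf.1 fun x => by positivity] at h1
  simp only [← norm_gradient] at h1
  have e : ∫ x in (Ω : Set (Rn n)), ‖gradient φ x‖ ^ s = ∫ x, ‖gradient φ x‖ ^ s :=
    setIntegral_eq_integral_of_forall_compl_eq_zero fun x hx => by
      rw [gradient_testFunction_eq_zero φ hx, norm_zero, Real.zero_rpow hs0.ne']
  rw [← e] at h1
  have hi1 : IntegrableOn (fun x => ‖f x‖ ^ r * |φ x| ^ s) Ω := by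
    obtain ⟨B, hB⟩ := φ.continuous.bounded_above_of_compact_support φ.hasCompactSupport
    refine hf.1.mul_bdd (c := B ^ s)
      (φ.continuous.abs.rpow_const fun x => Or.inr hs0.le).aestronglyMeasurable
      (ae_of_all _ fun x => ?_)
    rw [Real.norm_of_nonneg (by positivity)]
    exact Real.rpow_le_rpow (abs_nonneg _) (hB x) hs0.le
  have hi2 : IntegrableOn (fun x => ‖gradient φ x‖ ^ s) Ω :=
    integrable_rpow_of_compactSupport hs0 (continuous_gradient hφ)
      (hasCompactSupport_gradient φ.hasCompactSupport)
  have h2 := norm_integral_le_of_norm_le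
    (f := fun x => inner ℝ (f x) (gradient (fun x => |φ x| ^ s) x)) ((hi1.add hi2).const_mul s) (ae_of_all _
      fun x =>
    abs_inner_gradient_abs_rpow_le hrs (hφ.differentiable one_ne_zero) (f x) x)
  refine h2.trans ?_
  rw [integral_const_mul]
  simp only [Pi.add_apply]
  rw [integral_add hi1 hi2, mul_assoc]
  refine mul_le_mul_of_nonneg_left ?_ hs0.le
  linarith

end pairingBound

/-! ### The datum as a divergence, and the theorem -/

theorem memLp_of_funMemM_rpow {n : ℕ} {r s : ℝ} (hr : 0 < r) {Ω : Set (Rn n)} {f : Rn n → Rn n}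
    (hfm : AEStronglyMeasurable f (volume.restrict Ω)) (hf : FunMemM s Ω fun x => ‖f x‖ ^ r) :
    MemLp f (ENNReal.ofReal r) (volume.restrict Ω) := by
  rw [← integrable_norm_rpow_iff hfm (by simpa using hr) ENNReal.ofReal_ne_top,
    ENNReal.toReal_ofReal hr.le]
  exact hf.1

/-- A solution of the Riccati equation with `|∇u|^q` in `M^{1,s}(Ω)` exhibits the datum as the
divergence of a field `f` with `|f|^{q/(p-1)}` in `M^{1,s}(Ω)`. -/
theorem SolvesRiccati.exists_isDiv {n : ℕ} (i : Fin n) {Ω : Opens (Rn n)} {R p q r s Λ : ℝ}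
    (hR : 0 < R) (hΩR : (Ω : Set (Rn n)) ⊆ Metric.closedBall 0 R) (hrs : r.HolderConjugate s)
    (hpr : (p - 1) * r = q) {A : Rn n → Rn n → Rn n} (hA : IsCaratheodoryWithGrowth A p Λ)
    {σ : 𝓓'(Ω, ℝ)} {Du : Rn n → Rn n} (hM : FunMemM s Ω fun x => ‖Du x‖ ^ q)
    (hsol : SolvesRiccati Ω A q Du σ) :
    ∃ f : Rn n → Rn n, MemLp f (ENNReal.ofReal r) (volume.restrict (Ω : Set (Rn n))) ∧
      IsDiv Ω σ f ∧ FunMemM s Ω fun x => ‖f x‖ ^ r := by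
  have hΩm : MeasurableSet (Ω : Set (Rn n)) := Ω.isOpen.measurableSet
  have hfin : IsFiniteMeasure (volume.restrict (Ω : Set (Rn n))) :=
    isFiniteMeasure_restrict.2
      ((measure_mono hΩR).trans_lt (isCompact_closedBall (0 : Rn n) R).measure_lt_top).ne
  have hs : 1 < s := hrs.symm.lt
  have hr : 1 < r := hrs.lt
  have hr1 : (1 : ℝ≥0∞) ≤ ENNReal.ofReal r := by simpa using ENNReal.ofReal_le_ofReal hr.le
  obtain ⟨F, hFm, hFdiv, hFM⟩ := hM.exists_field i hs hR hΩR fun x => by positivity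
  rw [show s / (s - 1) = r from hrs.symm.conjugate_eq.symm] at hFM
  -- Measurability of the composed field is read off from its local integrability, which is part of
  -- the equation.
  have hAm : AEStronglyMeasurable (fun x => A x (Du x)) (volume.restrict (Ω : Set (Rn n))) :=
    hsol.1.aestronglyMeasurable
  have hAb : ∀ᵐ x ∂volume.restrict (Ω : Set (Rn n)),
      ‖A x (Du x)‖ ^ r ≤ |Λ| ^ r * ‖Du x‖ ^ q := by
    filter_upwards [ae_restrict_of_ae hA.growth] with x hx
    rw [← hpr, Real.rpow_mul (norm_nonneg _), ← Real.mul_rpow (abs_nonneg _) (by positivity)]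
    refine Real.rpow_le_rpow (norm_nonneg _) ((hx (Du x)).trans ?_) (by linarith)
    exact mul_le_mul_of_nonneg_right (le_abs_self _) (by positivity)
  have hAM : FunMemM s Ω fun x => ‖A x (Du x)‖ ^ r :=
    FunMemM.of_ae_le (by linarith) (by positivity) hΩm (fun x => by positivity)
      (hAm.norm.aemeasurable.pow_const r).aestronglyMeasurable (fun x => by positivity)
      (fun x => by positivity) hM hM (c := |Λ| ^ r) (hAb.mono fun x hx => hx.trans
        (mul_le_mul_of_nonneg_left (le_add_of_nonneg_left (by positivity)) (by positivity)))
  -- The field sought is F - A(x, Du): the equation reads σ(φ) = ∫ A·∇φ - ∫ F·∇φ.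
  have hfm : AEStronglyMeasurable (fun x => F x - A x (Du x))
      (volume.restrict (Ω : Set (Rn n))) := hFm.aestronglyMeasurable.sub hAm
  have hfM : FunMemM s Ω fun x => ‖F x - A x (Du x)‖ ^ r :=
    FunMemM.of_ae_le (by linarith) (by positivity) hΩm (fun x => by positivity)
      (hfm.norm.aemeasurable.pow_const r).aestronglyMeasurable (fun x => by positivity)
      (fun x => by positivity) hFM hAM (c := 2 ^ r) (ae_of_all _ fun x =>
        (Real.rpow_le_rpow (norm_nonneg _) (norm_sub_le _ _) (by linarith)).trans
          (add_rpow_le_two_rpow_mul (by linarith) (norm_nonneg _) (norm_nonneg _)))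
  have hfL := memLp_of_funMemM_rpow (by linarith) hfm hfM
  have hfi : IntegrableOn (fun x => F x - A x (Du x)) Ω := hfL.integrable hr1
  refine ⟨_, hfL, ⟨hfi.locallyIntegrableOn,
    fun φ => ?_⟩, hfM⟩
  obtain ⟨B, hB⟩ := (continuous_gradient (contDiff_one_testFunction φ))
    |>.bounded_above_of_compact_support (hasCompactSupport_gradient φ.hasCompactSupport)
  have hi : ∀ G : Rn n → Rn n, AEStronglyMeasurable G (volume.restrict (Ω : Set (Rn n))) →
      (FunMemM s Ω fun x => ‖G x‖ ^ r) →
      IntegrableOn (fun x => inner ℝ (G x) (gradient φ x)) Ω := by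
    intro G hGm hG
    refine (((memLp_of_funMemM_rpow (by linarith) hGm hG).integrable hr1).norm.const_mul B).mono'
      (hGm.inner (continuous_gradient (contDiff_one_testFunction φ)).aestronglyMeasurable)
      (ae_of_all _ fun x => (norm_inner_le_norm _ _).trans ?_)
    rw [mul_comm]
    exact mul_le_mul_of_nonneg_right (hB x) (norm_nonneg _)
  have h1 := hsol.2.2 φ
  rw [hFdiv φ] at h1
  simp only [inner_sub_left]
  rw [integral_sub (hi F hFm.aestronglyMeasurable hFM) (hi _ hAm hAM), h1]
  ring

end Riccati

theorem theorem1p1 (n : ℕ) (hn : 2 ≤ n) (Ω : Opens (Riccati.Rn n))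
    (hΩ : IsConnected (Ω : Set (Riccati.Rn n)))
    (hΩb : Bornology.IsBounded (Ω : Set (Riccati.Rn n)))
    (p q Λ : ℝ) (hp : 1 < p) (hq : 1 ≤ q) (hqp : p - 1 < q)
    (A : Riccati.Rn n → Riccati.Rn n → Riccati.Rn n)
    (hA : Riccati.IsCaratheodoryWithGrowth A p Λ)
    (σ : 𝓓'(Ω, ℝ)) (u : Riccati.Rn n → ℝ) (Du : Riccati.Rn n → Riccati.Rn n)
    (hu : Riccati.MemSobolev Ω q u Du)
    (hM : Riccati.FunMemM (q / (q - p + 1)) Ω (fun x => ‖Du x‖ ^ q))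
    (hsol : Riccati.SolvesRiccati Ω A q Du σ) :
    (∃ f : Riccati.Rn n → Riccati.Rn n, Riccati.IsDiv Ω σ f ∧
      Riccati.FunMemM (q / (q - p + 1)) Ω (fun x => ‖f x‖ ^ (q / (p - 1)))) ∧
    Riccati.MemNegSobolev Ω (q / (p - 1)) σ ∧
    ∃ C : ℝ, ∀ φ : 𝓓(Ω, ℝ), ∃ ℓ : ℝ,
      Riccati.HasPairing Ω (q / (q - p + 1)) σ (fun x => |φ x| ^ (q / (q - p + 1))) ℓ ∧
      |ℓ| ≤ C * ∫ x in (Ω : Set (Riccati.Rn n)), ‖gradient φ x‖ ^ (q / (q - p + 1)) := by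
  have hp1 : 0 < p - 1 := by linarith
  have hqp1 : 0 < q - p + 1 := by linarith
  have hr : 1 < q / (p - 1) := by rwa [one_lt_div hp1]
  have hrs : (q / (p - 1)).HolderConjugate (q / (q - p + 1)) := by
    rw [Real.holderConjugate_iff]
    refine ⟨hr, ?_⟩
    have : q ≠ 0 := by linarith
    field_simp
    ring
  have hpr : (p - 1) * (q / (p - 1)) = q := by field_simp
  set r := q / (p - 1)
  set s := q / (q - p + 1)
  have hs : 1 < s := hrs.symm.lt
  -- Some coordinate direction is needed for the Poincaré inequality.
  let i : Fin n := ⟨0, by omega⟩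
  obtain ⟨R, hR, hΩR⟩ := hΩb.subset_closedBall_lt 0 0
  have hfin : IsFiniteMeasure (volume.restrict (Ω : Set (Riccati.Rn n))) :=
    isFiniteMeasure_restrict.2
      ((measure_mono hΩR).trans_lt (isCompact_closedBall (0 : Riccati.Rn n) R).measure_lt_top).ne
  obtain ⟨f, hf, hσ, hfM⟩ := hsol.exists_isDiv i hR hΩR hrs hpr hA hM
  obtain ⟨C, hC⟩ := Riccati.exists_integral_inner_gradient_abs_rpow_le i hrs hR.le hΩR hfM
  refine ⟨⟨f, hσ, hfM⟩, hσ.memNegSobolev hr hf, C, fun φ =>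
    ⟨_, Riccati.hasPairing_of_contDiff hrs hf hσ
      ((Riccati.contDiff_one_testFunction φ).norm_rpow hs) ?_ ?_, ?_⟩⟩
  · exact φ.hasCompactSupport.comp_left (g := fun t : ℝ => ‖t‖ ^ s)
      (by simp [Real.zero_rpow (by linarith : s ≠ 0)])
  · refine (closure_mono fun x hx => ?_).trans φ.tsupport_subset
    exact fun h => hx (by simp [h, Real.zero_rpow (by linarith : s ≠ 0)])
  · rw [abs_neg]
    exact hC φ
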